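/- Let $\mathbb{G}$ and $\mathbb{H}$ be Carnot groups, i.e. simply connected Lie groups whose Lie algebras are stratified: $\mathfrak{g}=V_1\oplus\cdots\oplus V_s$ with $V_{i}=[V_1,V_{i-1}]$ for $2\le i\le s$ and $[V_1,V_s]=0$, and similarly $\mathfrak{h}=W_1\oplus\cdots\oplus W_{s'}$ (the steps $s$, $s'$ may differ). Let $X_1,\dots,X_r$ and $Y_1,\dots,Y_r$ be bases of the horizontal layers $V_1$ and $W_1$, and let $F\colon\mathbb{G}\to\mathbb{H}$ be a Lie group homomorphism with $F_*(X_i)=Y_i$ for $1\le i\le r$. Equip $\mathbb{G}$ and $\mathbb{H}$ with the Carnot-Carathéodory (CC) distances induced by these bases: $d(x,y)$ is the infimum of $\int_a^b|u|$ over the absolutely continuous curves $\gamma\colon[a,b]\to\mathbb{G}$ joining $x$ to $y$ for which there is $u\in L^1([a,b];\mathbb{R}^r)$ with $\gamma'(t)=\sum_j u_j(t)X_j(\gamma(t))$ for almost every $t$ (and similarly in $\mathbb{H}$ with the $Y_j$). A function $L\colon\mathbb{G}\to\mathbb{R}$ is $\mathbb{G}$-linear if $L(xy)=L(x)+L(y)$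 and $L(\delta_c(x))=cL(x)$ for all $x,y\in\mathbb{G}$ and $c>0$, where $\delta_c(\exp(v_1+\cdots+v_s))=\exp(cv_1+\cdots+c^sv_s)$ for $v_i\in V_i$. A function $f\colon\mathbb{G}\to\mathbb{R}$ is Pansu differentiable at $x$ if there is a $\mathbb{G}$-linear $L$ with $\lim_{y\to x}|f(y)-f(x)-L(x^{-1}y)|/d(x,y)=0$. A set $N\subset\mathbb{G}$ is a universal differentiability set if every function $f\colon\mathbb{G}\to\mathbb{R}$ that is Lipschitz with respect to $d$ is Pansu differentiable at some point of $N$. The CC-Hausdorff dimension of a set is its Hausdorff dimension with respect to the CC distance. The same notions are used in $\mathbb{H}$. If $N$ is a universal differentiability set in $\mathbb{G}$, then $F(N)$ is a universal differentiability set in $\mathbb{H}$. If moreover $N$ has CC-Hausdorff dimension one, then $F(N)$ has CC-Hausdorff dimension one. -/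

import Mathlib

open scoped Manifold ContDiff NNReal
open MeasureTheory Set

noncomputable section

/-! ### Hausdorff dimension with respect to a distance function -/

section HausdorffDimension

variable {M : Type*}

/-- Diameter of a set with respect to the distance `d`. -/
def distDiam (d : M → M → ENNReal) (A : Set M) : ENNReal :=
  ⨆ x ∈ A, ⨆ y ∈ A, d x y

/-- The `s`-dimensional Hausdorff (outer) measure of `A` with respect to the distance `d`:
the limit as `ρ → 0` of the infimum of `∑ (diam Uₙ) ^ s` over countable covers of `A` by sets of
diameter at most `ρ` (empty sets contribute `0`). -/
def hausdorffMeasureOf (d : M → M → ENNReal) (s : ℝ) (A : Set M) : ENNReal :=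
  ⨆ (ρ : ENNReal) (_ : 0 < ρ),
    ⨅ (U : ℕ → Set M) (_ : A ⊆ ⋃ n, U n) (_ : ∀ n, distDiam d (U n) ≤ ρ),
      ∑' n, ⨆ _ : (U n).Nonempty, distDiam d (U n) ^ s

/-- The Hausdorff dimension of `A` with respect to the distance `d`. -/
def hausdorffDimOf (d : M → M → ENNReal) (A : Set M) : ENNReal :=
  ⨆ (s : ℝ≥0) (_ : hausdorffMeasureOf d s A = ⊤), (s : ENNReal)

end HausdorffDimension

/-! ### Carnot groups

A Carnot group is a simply connected (real, smooth, finite dimensional) Lie group together with a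
stratification of its Lie algebra. The Lie algebra is Mathlib's `GroupLieAlgebra`, the tangent space
at the identity with the bracket of left invariant vector fields. -/

section Carnot

variable {E : Type*} [NormedAddCommGroup E] [NormedSpace ℝ E]
  {G : Type*} [TopologicalSpace G] [ChartedSpace E G] [Group G]

variable (E G) in
/-- A stratification `𝔤 = V₁ ⊕ ⋯ ⊕ Vₛ` of the Lie algebra of `G`, with
`Vᵢ₊₁ = [V₁, Vᵢ]` for `1 ≤ i < s` and `[V₁, Vₛ] = 0`. The layer `Vᵢ` is `layer i`; only the indices
`1, …, s` are meaningful. -/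
structure Stratification where
  step : ℕ
  step_pos : 0 < step
  layer : ℕ → Submodule ℝ (GroupLieAlgebra 𝓘(ℝ, E) G)
  isInternal : DirectSum.IsInternal fun i : Fin step => layer (i + 1)
  layer_succ : ∀ i, 1 ≤ i → i < step →
    layer (i + 1) = Submodule.span ℝ {z | ∃ x ∈ layer 1, ∃ y ∈ layer i, ⁅x, y⁆ = z}
  bracket_layer_step : ∀ x ∈ layer 1, ∀ y ∈ layer step, ⁅x, y⁆ = 0

namespace Stratification

/-- The horizontal layer `V₁`. -/
abbrev horizontal (S : Stratification E G) : Submodule ℝ (GroupLieAlgebra 𝓘(ℝ, E) G) :=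
  S.layer 1

/-- The dilation of the Lie algebra by the factor `c`: the linear map that acts on `Vᵢ` as
multiplication by `c ^ i`. -/
def algDilation (S : Stratification E G) (c : ℝ) :
    GroupLieAlgebra 𝓘(ℝ, E) G →ₗ[ℝ] GroupLieAlgebra 𝓘(ℝ, E) G :=
  (DirectSum.toModule ℝ (Fin S.step) (GroupLieAlgebra 𝓘(ℝ, E) G)
      fun i => c ^ ((i : ℕ) + 1) • (S.layer (i + 1)).subtype) ∘ₗ
    (LinearEquiv.ofBijective
      (DirectSum.coeLinearMap fun i : Fin S.step => S.layer (i + 1)) S.isInternal).symm.toLinearMap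

theorem algDilation_apply_of_mem (S : Stratification E G) (c : ℝ) (i : Fin S.step)
    {v : GroupLieAlgebra 𝓘(ℝ, E) G} (hv : v ∈ S.layer (i + 1)) :
    S.algDilation c v = c ^ ((i : ℕ) + 1) • v := by
  have h : (LinearEquiv.ofBijective
      (DirectSum.coeLinearMap fun i : Fin S.step => S.layer (i + 1)) S.isInternal).symm v =
      DirectSum.lof ℝ (Fin S.step) (fun i : Fin S.step => S.layer (i + 1)) i ⟨v, hv⟩ :=
    (LinearEquiv.symm_apply_eq _).2
      (DirectSum.coeLinearMap_lof (fun i : Fin S.step => S.layer (i + 1)) i ⟨v, hv⟩).symm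
  calc S.algDilation c v
      = DirectSum.toModule ℝ (Fin S.step) (GroupLieAlgebra 𝓘(ℝ, E) G)
          (fun i => c ^ ((i : ℕ) + 1) • (S.layer (i + 1)).subtype)
          (DirectSum.lof ℝ (Fin S.step) (fun i : Fin S.step => S.layer (i + 1)) i ⟨v, hv⟩) :=
        congrArg (DirectSum.toModule ℝ (Fin S.step) (GroupLieAlgebra 𝓘(ℝ, E) G)
          fun i => c ^ ((i : ℕ) + 1) • (S.layer (i + 1)).subtype) h
    _ = c ^ ((i : ℕ) + 1) • v := by
        rw [DirectSum.toModule_lof]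
        rfl

end Stratification

/-- The exponential map of the Lie group `G`: `lieExp v` is the value at time `1` of the integral
curve, starting at the identity, of the left invariant vector field associated with `v`. -/
def lieExp (v : GroupLieAlgebra 𝓘(ℝ, E) G) : G :=
  Classical.epsilon fun g : G => ∃ γ : ℝ → G, γ 0 = 1 ∧
    IsMIntegralCurve (I := 𝓘(ℝ, E)) γ (mulInvariantVectorField v) ∧ γ 1 = g

/-- A curve in `G`, defined on `[a, b]`, is absolutely continuous if it is so in smooth coordinates,
that is, if it is continuous and its composition with each smooth real function is absolutely
continuous. -/
def AbsContCurve (E : Type*) [NormedAddCommGroup E] [NormedSpace ℝ E] {G : Type*}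
    [TopologicalSpace G] [ChartedSpace E G] (γ : ℝ → G) (a b : ℝ) : Prop :=
  ContinuousOn γ (Icc a b) ∧
    ∀ φ : G → ℝ, ContMDiff 𝓘(ℝ, E) 𝓘(ℝ, ℝ) ∞ φ → AbsolutelyContinuousOnInterval (φ ∘ γ) a b

/-- The curve `γ : [a, b] → G` is horizontal with controls `u = (u₁, …, u_r) ∈ L¹[a, b]`, with
respect to the left invariant vector fields `X₁, …, X_r`:
`γ' (t) = ∑ uⱼ(t) Xⱼ(γ (t))` for almost every `t ∈ [a, b]`. -/
def IsHorizontalCurve {r : ℕ} (X : Fin r → GroupLieAlgebra 𝓘(ℝ, E) G) (a b : ℝ) (γ : ℝ → G)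
    (u : ℝ → EuclideanSpace ℝ (Fin r)) : Prop :=
  AbsContCurve E γ a b ∧ IntegrableOn u (Icc a b) ∧
    ∀ᵐ t ∂(volume.restrict (Icc a b)),
      HasMFDerivAt 𝓘(ℝ, ℝ) 𝓘(ℝ, E) γ t
        ((1 : ℝ →L[ℝ] ℝ).smulRight (∑ j, u t j • mulInvariantVectorField (X j) (γ t)))

/-- The Carnot-Carathéodory distance induced by `X₁, …, X_r`: the infimum of the lengths `∫ |u|` of
the horizontal curves joining `x` to `y`. -/
def ccDist {r : ℕ} (X : Fin r → GroupLieAlgebra 𝓘(ℝ, E) G) (x y : G) : ENNReal :=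
  ⨅ (a : ℝ) (b : ℝ) (γ : ℝ → G) (u : ℝ → EuclideanSpace ℝ (Fin r))
    (_ : a ≤ b ∧ IsHorizontalCurve X a b γ u ∧ γ a = x ∧ γ b = y),
    ∫⁻ t in Icc a b, ‖u t‖ₑ

/-- A function `L : G → ℝ` is `G`-linear if `L (x * y) = L x + L y` and `L (δ_c x) = c * L x` for all
`c > 0`. Here `δ_c` is the dilation of the group, given in exponential coordinates `x = exp v` by
`δ_c (exp v) = exp (c • v₁ + c ^ 2 • v₂ + ⋯ + c ^ s • vₛ)`. -/
def IsGLinear (S : Stratification E G) (L : G → ℝ) : Prop :=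
  (∀ x y, L (x * y) = L x + L y) ∧
    ∀ c : ℝ, 0 < c → ∀ v : GroupLieAlgebra 𝓘(ℝ, E) G,
      L (lieExp (S.algDilation c v)) = c * L (lieExp v)

/-- `f` is Lipschitz with respect to the Carnot-Carathéodory distance. -/
def IsCCLipschitz {r : ℕ} (X : Fin r → GroupLieAlgebra 𝓘(ℝ, E) G) (f : G → ℝ) : Prop :=
  ∃ K : ℝ≥0, ∀ x y, edist (f x) (f y) ≤ K * ccDist X x y

/-- Pansu differentiability of `f : G → ℝ` at `x`: there is a `G`-linear `L` such that
`|f y - f x - L (x⁻¹ y)| / d(x, y) → 0` as `y → x`. -/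
def IsPansuDifferentiableAt (S : Stratification E G) {r : ℕ}
    (X : Fin r → GroupLieAlgebra 𝓘(ℝ, E) G) (f : G → ℝ) (x : G) : Prop :=
  ∃ L : G → ℝ, IsGLinear S L ∧
    ∀ ε : ℝ≥0, 0 < ε → ∃ δ : ℝ≥0, 0 < δ ∧ ∀ y, ccDist X x y < δ →
      ENNReal.ofReal |f y - f x - L (x⁻¹ * y)| ≤ ε * ccDist X x y

/-- `N` is a universal differentiability set: each Lipschitz `f : G → ℝ` is Pansu differentiable at
some point of `N`. -/
def IsUDS (S : Stratification E G) {r : ℕ}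
    (X : Fin r → GroupLieAlgebra 𝓘(ℝ, E) G) (N : Set G) : Prop :=
  ∀ f : G → ℝ, IsCCLipschitz X f → ∃ x ∈ N, IsPansuDifferentiableAt S X f x

/-- The CC-Hausdorff dimension of a set. -/
def ccDimH {r : ℕ} (X : Fin r → GroupLieAlgebra 𝓘(ℝ, E) G) (N : Set G) : ENNReal :=
  hausdorffDimOf (ccDist X) N

end Carnot

end

/-! Since `F` carries the frame `X` to the frame `Y`, it pushes horizontal curves forward with the
same controls and hence the same length, so it is 1-Lipschitz for the CC distances
(`ccDist_map_le`). For `f` Lipschitz on `H`, the function `f ∘ F` is therefore Lipschitz on `G` and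
has a Pansu differential `L` at some `x ∈ N`.

The differential descends to `H`. A `G`-linear function kills the exponentials of the layers of
index at least 2, so it is determined by its values on the `exp X_j` (`IsGLinear.eq_of_lieExp`).
These values are realised on `H` by an `H`-linear `p` (`Stratification.exists_isGLinear`): a
functional on the first layer, extended by zero, vanishes on brackets, so the left invariant
one-form it defines is closed, and simple connectedness integrates it to a homomorphism. Then `p ∘ F
= L`.

The estimate descends as well. A short horizontal curve from `F x` to `z` lifts to a horizontal
curve from `x` with the same controls (`exists_lift_of_isHorizontalCurve`): the controlled equation
is solvable in `G` for small controls, and its solutions in `H` are unique. The end point `y` of the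
lift satisfies `F y = z`, and `d(x, y)` is at most the length of the curve, so the estimate for `f ∘
F` at `y` is the one required for `f` at `z`.

For the dimension, the upper bound is the Lipschitz property of `F`. The lower bound holds for every
universal differentiability set when the horizontal layer is nonzero (`IsUDS.one_le_ccDimH`). If the
dimension were less than one, a horizontal coordinate `p` would map the set to a Lebesgue null set
(`volume_image_eq_zero_of_hausdorffMeasureOf_ne_top`). Some Lipschitz `g : ℝ → ℝ` is differentiable
at no point of that null set (`exists_lipschitzWith_not_differentiableAt`), and `g ∘ p` would then
be Pansu differentiable nowhere on the original set. If the horizontal layer is zero, the group is a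
point, and dimension one is impossible. -/

noncomputable section

/-! ### Derivatives in the left invariant frame -/

section FrameDefinition

variable {E : Type*} [NormedAddCommGroup E] [NormedSpace ℝ E]
  {G : Type*} [TopologicalSpace G] [ChartedSpace E G]
  {V : Type*} [NormedAddCommGroup V] [NormedSpace ℝ V]

variable (E) in
/-- The derivative of `φ : G → V` at `g` in the left invariant frame: the vector `v` of the Lie
algebra is sent to the derivative of `φ` along the left invariant field of `v`. -/
def frameDeriv [Group G] (φ : G → V) (g : G) : E →L[ℝ] V :=
  -- The chart at `1` identifies the Lie algebra with `E`. The values lie in the fixed space `E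
  -- →L[ℝ] V`, so continuity and smoothness in `g` make sense without bundles.
  fderiv ℝ (fun y : E => φ (g * (extChartAt 𝓘(ℝ, E) (1 : G)).symm y))
    (extChartAt 𝓘(ℝ, E) (1 : G) 1)

theorem HasMFDerivAt.hasFDerivAt_comp_extChartAt_symm {φ : G → V} {g : G} {L : E →L[ℝ] V}
    (h : HasMFDerivAt 𝓘(ℝ, E) 𝓘(ℝ, V) φ g L) :
    HasFDerivAt (fun y : E => φ ((extChartAt 𝓘(ℝ, E) g).symm y)) L (extChartAt 𝓘(ℝ, E) g g) := by
  have h2 := h.2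
  rw [ModelWithCorners.range_eq_univ] at h2
  exact h2.hasFDerivAt Filter.univ_mem

theorem ContinuousLinearMap.isInvertible_of_comp_eq {E₁ E₂ : Type*} [NormedAddCommGroup E₁]
    [NormedSpace ℝ E₁] [NormedAddCommGroup E₂] [NormedSpace ℝ E₂] {A : E₁ →L[ℝ] E₂}
    {B : E₂ →L[ℝ] E₁} (h₁ : A.comp B = .id ℝ E₂) (h₂ : B.comp A = .id ℝ E₁) : A.IsInvertible :=
  ContinuousLinearMap.IsInvertible.of_inverse h₁ h₂

theorem mulInvariantVectorField_sum_smul {ι : Type*} [Group G] (s : Finset ι) (c : ι → ℝ)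
    (X : ι → GroupLieAlgebra 𝓘(ℝ, E) G) (g : G) :
    ∑ j ∈ s, c j • mulInvariantVectorField (X j) g =
      mulInvariantVectorField (∑ j ∈ s, c j • X j) g := by
  simp only [mulInvariantVectorField, map_sum, map_smul]
  rfl

end FrameDefinition

section Frame

variable {E : Type*} [NormedAddCommGroup E] [NormedSpace ℝ E]
  {G : Type*} [TopologicalSpace G] [ChartedSpace E G] [Group G]
  {V : Type*} [NormedAddCommGroup V] [NormedSpace ℝ V]
  [LieGroup 𝓘(ℝ, E) ∞ G]

theorem contMDiffAt_symm_extChartAt_of_mem {x₀ : G} {x : E}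
    (hx : x ∈ (extChartAt 𝓘(ℝ, E) x₀).target) :
    ContMDiffAt 𝓘(ℝ, E) 𝓘(ℝ, E) ∞ (extChartAt 𝓘(ℝ, E) x₀).symm x :=
  (contMDiffOn_extChartAt_symm x₀).contMDiffAt
    ((isOpen_extChartAt_target (I := 𝓘(ℝ, E)) x₀).mem_nhds hx)

theorem contMDiffAt_extChartAt_of_mem {x₀ g : G}
    (hg : g ∈ (extChartAt 𝓘(ℝ, E) x₀).source) :
    ContMDiffAt 𝓘(ℝ, E) 𝓘(ℝ, E) ∞ (extChartAt 𝓘(ℝ, E) x₀) g :=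
  contMDiffAt_extChartAt' (by simpa using hg)

theorem frameDeriv_eq_of_hasMFDerivAt {φ : G → V} {g : G} {L : E →L[ℝ] V}
    (hφ : HasMFDerivAt 𝓘(ℝ, E) 𝓘(ℝ, V) φ g L) (v : GroupLieAlgebra 𝓘(ℝ, E) G) :
    frameDeriv E φ g v = L (mulInvariantVectorField v g) := by
  have hm : MDifferentiableAt 𝓘(ℝ, E) 𝓘(ℝ, E) (g * ·) (1 : G) :=
    (contMDiff_mul_left (I := 𝓘(ℝ, E)) (n := ∞) (a := g)).contMDiffAt.mdifferentiableAt (by simp)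
  have hφ' : HasMFDerivAt 𝓘(ℝ, E) 𝓘(ℝ, V) φ (g * 1) L := by
    have : ∀ g', g' = g → HasMFDerivAt 𝓘(ℝ, E) 𝓘(ℝ, V) φ g' L := by rintro _ rfl; exact hφ
    exact this _ (mul_one g)
  have h1 := (hφ'.comp (1 : G) hm.hasMFDerivAt).hasFDerivAt_comp_extChartAt_symm
  exact congrArg (fun L : E →L[ℝ] V => L v) h1.fderiv

/-- Joint smoothness in the base point and the increment makes the partial derivative in the
increment, which is the frame derivative, smooth in the base point. -/
theorem contDiffAt_comp_mul_symm {φ : G → V} {x₀ : G} {x : E}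
    (hx : x ∈ (extChartAt 𝓘(ℝ, E) x₀).target)
    (hφ : ContMDiffAt 𝓘(ℝ, E) 𝓘(ℝ, V) ∞ φ ((extChartAt 𝓘(ℝ, E) x₀).symm x)) :
    ContDiffAt ℝ ∞ (fun p : E × E => φ ((extChartAt 𝓘(ℝ, E) x₀).symm p.1 *
      (extChartAt 𝓘(ℝ, E) (1 : G)).symm p.2)) (x, extChartAt 𝓘(ℝ, E) (1 : G) 1) := by
  rw [← contMDiffAt_iff_contDiffAt]
  have h1 := contMDiffAt_symm_extChartAt_of_mem hx
  have h2 := contMDiffAt_symm_extChartAt_of_mem (mem_extChartAt_target (I := 𝓘(ℝ, E)) (1 : G))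
  have h3 : ContMDiffAt 𝓘(ℝ, E × E) 𝓘(ℝ, E) ∞ (fun p : E × E =>
      (extChartAt 𝓘(ℝ, E) x₀).symm p.1 * (extChartAt 𝓘(ℝ, E) (1 : G)).symm p.2)
      (x, extChartAt 𝓘(ℝ, E) (1 : G) 1) :=
    (h1.comp (x, extChartAt 𝓘(ℝ, E) (1 : G) 1) contDiff_fst.contMDiff.contMDiffAt).mul
      (h2.comp (x, extChartAt 𝓘(ℝ, E) (1 : G) 1) contDiff_snd.contMDiff.contMDiffAt)
  refine ContMDiffAt.comp (I' := 𝓘(ℝ, E)) (x, extChartAt 𝓘(ℝ, E) (1 : G) 1) ?_ h3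
  have : (extChartAt 𝓘(ℝ, E) x₀).symm x * (extChartAt 𝓘(ℝ, E) (1 : G)).symm
      (extChartAt 𝓘(ℝ, E) (1 : G) 1) = (extChartAt 𝓘(ℝ, E) x₀).symm x := by
    rw [extChartAt_to_inv, mul_one]
  simpa only [this] using hφ

theorem contDiffAt_frameDeriv {φ : G → V} {x₀ : G} {x : E}
    (hx : x ∈ (extChartAt 𝓘(ℝ, E) x₀).target)
    (hφ : ContMDiffAt 𝓘(ℝ, E) 𝓘(ℝ, V) ∞ φ ((extChartAt 𝓘(ℝ, E) x₀).symm x)) :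
    ContDiffAt ℝ ∞ (fun y => frameDeriv E φ ((extChartAt 𝓘(ℝ, E) x₀).symm y)) x := by
  unfold frameDeriv
  exact ContDiffAt.fderiv (n := ∞) (f := fun (y z : E) => φ ((extChartAt 𝓘(ℝ, E) x₀).symm y *
    (extChartAt 𝓘(ℝ, E) (1 : G)).symm z)) (contDiffAt_comp_mul_symm hx hφ)
    contDiffAt_const (by simp)

theorem continuous_frameDeriv {φ : G → V} (hφ : ContMDiff 𝓘(ℝ, E) 𝓘(ℝ, V) ∞ φ) :
    Continuous (frameDeriv E φ) := by
  rw [continuous_iff_continuousAt]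
  intro g
  have h := (contDiffAt_frameDeriv (mem_extChartAt_target (I := 𝓘(ℝ, E)) g) (φ := φ)
    hφ.contMDiffAt).continuousAt
  have h2 := h.comp (continuousAt_extChartAt (I := 𝓘(ℝ, E)) g)
  refine h2.congr ?_
  filter_upwards [extChartAt_source_mem_nhds (I := 𝓘(ℝ, E)) g] with y hy
  exact congrArg (frameDeriv E φ) ((extChartAt 𝓘(ℝ, E) g).left_inv hy)

theorem differentiableAt_comp_mul_symm {φ : G → V} {g : G}
    (hφ : ContMDiffAt 𝓘(ℝ, E) 𝓘(ℝ, V) ∞ φ g) :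
    DifferentiableAt ℝ (fun y : E => φ (g * (extChartAt 𝓘(ℝ, E) (1 : G)).symm y))
      (extChartAt 𝓘(ℝ, E) (1 : G) 1) := by
  have h := contDiffAt_comp_mul_symm (φ := φ) (mem_extChartAt_target (I := 𝓘(ℝ, E)) g)
    (by rwa [extChartAt_to_inv])
  have h2 : ContDiffAt ℝ ∞ (fun y : E => (extChartAt 𝓘(ℝ, E) g g, y))
    (extChartAt 𝓘(ℝ, E) (1 : G) 1) := contDiffAt_const.prodMk contDiffAt_id
  have h3 := (h.comp _ h2).differentiableAt (by simp)
  simpa only [Function.comp_def, extChartAt_to_inv] using h3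

theorem tendsto_mul_symm_extChartAt_one (g : G) :
    Filter.Tendsto (fun y : E => g * (extChartAt 𝓘(ℝ, E) (1 : G)).symm y)
      (nhds (extChartAt 𝓘(ℝ, E) (1 : G) 1)) (nhds g) := by
  have h2 := (contMDiffAt_symm_extChartAt_of_mem
    (mem_extChartAt_target (I := 𝓘(ℝ, E)) (1 : G))).continuousAt
  have h : ContMDiff 𝓘(ℝ, E) 𝓘(ℝ, E) ∞ (g * · : G → G) := contMDiff_mul_left
  have h3 := (h.continuous.tendsto _).comp h2
  simpa only [Function.comp_def, extChartAt_to_inv, mul_one] using h3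

/-- Chain rule: the frame derivative computed in a chart. -/
theorem frameDeriv_eq_comp {φ : G → V} {x₀ g : G} (hg : g ∈ (extChartAt 𝓘(ℝ, E) x₀).source)
    {D : E →L[ℝ] V}
    (hD : HasFDerivAt (fun y : E => φ ((extChartAt 𝓘(ℝ, E) x₀).symm y)) D
      (extChartAt 𝓘(ℝ, E) x₀ g)) :
    frameDeriv E φ g = D.comp (frameDeriv E (extChartAt 𝓘(ℝ, E) x₀) g) := by
  have h1 := (differentiableAt_comp_mul_symm (contMDiffAt_extChartAt_of_mem hg)).hasFDerivAt
  have h2 : extChartAt 𝓘(ℝ, E) x₀ (g * (extChartAt 𝓘(ℝ, E) (1 : G)).symm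
      (extChartAt 𝓘(ℝ, E) (1 : G) 1)) = extChartAt 𝓘(ℝ, E) x₀ g := by
    rw [extChartAt_to_inv, mul_one]
  have h3 := HasFDerivAt.comp (g := fun y : E => φ ((extChartAt 𝓘(ℝ, E) x₀).symm y)) (g' := D)
    (extChartAt 𝓘(ℝ, E) (1 : G) 1) (by rwa [h2]) h1
  refine HasFDerivAt.fderiv (h3.congr_of_eventuallyEq ?_)
  filter_upwards [(tendsto_mul_symm_extChartAt_one g).eventually
    ((isOpen_extChartAt_source (I := 𝓘(ℝ, E)) x₀).mem_nhds hg)] with y hy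
  exact (congrArg φ ((extChartAt 𝓘(ℝ, E) x₀).left_inv hy)).symm

/-- The frame derivative of a chart is a linear isomorphism. -/
theorem isInvertible_frameDeriv_extChartAt {x₀ g : G} (hg : g ∈ (extChartAt 𝓘(ℝ, E) x₀).source) :
    (frameDeriv E (extChartAt 𝓘(ℝ, E) x₀) g).IsInvertible := by
  -- the local inverse of `y ↦ χ (g * χ₁⁻¹ y)` is `z ↦ χ₁ (g⁻¹ * χ⁻¹ z)`
  set ψ : G → E := fun h => extChartAt 𝓘(ℝ, E) (1 : G) (g⁻¹ * h) with hψ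
  have hψ' : ContMDiffAt 𝓘(ℝ, E) 𝓘(ℝ, E) ∞ ψ g := by
    refine ContMDiffAt.comp (I' := 𝓘(ℝ, E)) g ?_
      (contMDiff_mul_left (I := 𝓘(ℝ, E)) (n := ∞) (a := g⁻¹)).contMDiffAt
    rw [inv_mul_cancel]
    exact contMDiffAt_extChartAt_of_mem (mem_extChartAt_source _)
  have hD : DifferentiableAt ℝ (fun y : E => ψ ((extChartAt 𝓘(ℝ, E) x₀).symm y))
      (extChartAt 𝓘(ℝ, E) x₀ g) := by
    have : ContMDiffAt 𝓘(ℝ, E) 𝓘(ℝ, E) ∞ (ψ ∘ (extChartAt 𝓘(ℝ, E) x₀).symm)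
        (extChartAt 𝓘(ℝ, E) x₀ g) := by
      refine ContMDiffAt.comp (I' := 𝓘(ℝ, E)) _ ?_
        (contMDiffAt_symm_extChartAt_of_mem ((extChartAt 𝓘(ℝ, E) x₀).map_source hg))
      rwa [(extChartAt 𝓘(ℝ, E) x₀).left_inv hg]
    exact this.contDiffAt.differentiableAt (by simp)
  have h1 := frameDeriv_eq_comp hg hD.hasFDerivAt
  have h2 : frameDeriv E ψ g = .id ℝ E := by
    refine HasFDerivAt.fderiv ((hasFDerivAt_id _).congr_of_eventuallyEq ?_)
    filter_upwards [extChartAt_target_mem_nhds (I := 𝓘(ℝ, E)) (1 : G)] with y hy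
    simp only [hψ, inv_mul_cancel_left, id]
    exact (extChartAt 𝓘(ℝ, E) (1 : G)).right_inv hy
  -- `E` may be infinite dimensional here, so a one-sided inverse does not suffice: the opposite
  -- composition is differentiated too.
  have h3 : (frameDeriv E (extChartAt 𝓘(ℝ, E) x₀) g).comp
      (fderiv ℝ (fun y : E => ψ ((extChartAt 𝓘(ℝ, E) x₀).symm y)) (extChartAt 𝓘(ℝ, E) x₀ g)) =
      .id ℝ E := by
    have h4 := (differentiableAt_comp_mul_symm (contMDiffAt_extChartAt_of_mem hg)).hasFDerivAt
    have h5 : ψ ((extChartAt 𝓘(ℝ, E) x₀).symm (extChartAt 𝓘(ℝ, E) x₀ g)) =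
        extChartAt 𝓘(ℝ, E) (1 : G) 1 := by
      rw [(extChartAt 𝓘(ℝ, E) x₀).left_inv hg]; simp [hψ]
    rw [← h5] at h4
    have h6 := HasFDerivAt.comp (f := fun y : E => ψ ((extChartAt 𝓘(ℝ, E) x₀).symm y))
      (extChartAt 𝓘(ℝ, E) x₀ g) h4 hD.hasFDerivAt
    have h7 := h6.unique ((hasFDerivAt_id (𝕜 := ℝ) _).congr_of_eventuallyEq ?_)
    · rw [h5] at h7
      exact h7
    have h8 : ContMDiffAt 𝓘(ℝ, E) 𝓘(ℝ, E) ∞ (fun y => g⁻¹ * (extChartAt 𝓘(ℝ, E) x₀).symm y)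
        (extChartAt 𝓘(ℝ, E) x₀ g) :=
      (contMDiff_mul_left (I := 𝓘(ℝ, E)) (n := ∞) (a := g⁻¹)).contMDiffAt.comp _
        (contMDiffAt_symm_extChartAt_of_mem ((extChartAt 𝓘(ℝ, E) x₀).map_source hg))
    have h9 := h8.continuousAt.eventually_mem (s := (extChartAt 𝓘(ℝ, E) (1 : G)).source) (by
      rw [(extChartAt 𝓘(ℝ, E) x₀).left_inv hg, inv_mul_cancel]
      exact extChartAt_source_mem_nhds (1 : G))
    filter_upwards [h9, (isOpen_extChartAt_target (I := 𝓘(ℝ, E)) x₀).mem_nhds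
      ((extChartAt 𝓘(ℝ, E) x₀).map_source hg)] with y hy hy'
    simp only [Function.comp, hψ, id, (extChartAt 𝓘(ℝ, E) (1 : G)).left_inv hy,
      mul_inv_cancel_left]
    exact (extChartAt 𝓘(ℝ, E) x₀).right_inv hy'
  exact ContinuousLinearMap.isInvertible_of_comp_eq h3 (h1.symm.trans h2)

theorem HasMFDerivAt.hasDerivAt_comp_of_mulInvariant {φ : G → V} {γ : ℝ → G} {t : ℝ}
    {w : GroupLieAlgebra 𝓘(ℝ, E) G} (hφ : ContMDiffAt 𝓘(ℝ, E) 𝓘(ℝ, V) ∞ φ (γ t))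
    (hγ : HasMFDerivAt 𝓘(ℝ, ℝ) 𝓘(ℝ, E) γ t
      ((1 : ℝ →L[ℝ] ℝ).smulRight (mulInvariantVectorField w (γ t)))) :
    HasDerivAt (fun s => φ (γ s)) (frameDeriv E φ (γ t) w) t := by
  have h1 := (hφ.mdifferentiableAt (by simp)).hasMFDerivAt
  -- Names with types free of tangent spaces, so that the calculation takes place in `E` and `V`.
  obtain ⟨L, hL⟩ : ∃ L : E →L[ℝ] V, L = mfderiv 𝓘(ℝ, E) 𝓘(ℝ, V) φ (γ t) := ⟨_, rfl⟩
  obtain ⟨z, hz⟩ : ∃ z : E, z = mulInvariantVectorField w (γ t) := ⟨_, rfl⟩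
  have h2 : HasFDerivAt (fun s => φ (γ s)) (L.comp ((1 : ℝ →L[ℝ] ℝ).smulRight z)) t := by
    rw [hL, hz]
    exact (h1.comp t hγ).hasFDerivAt
  have h3 : frameDeriv E φ (γ t) w = L z := by
    rw [hL, hz]
    exact frameDeriv_eq_of_hasMFDerivAt h1 w
  rw [h3]
  simpa using h2.hasDerivAt

/-- A curve whose coordinates have the derivative prescribed by a left invariant field is tangent
to this field. -/
theorem hasMFDerivAt_of_hasDerivAt_extChartAt {γ : ℝ → G} {t : ℝ} {x₀ : G}
    {w : GroupLieAlgebra 𝓘(ℝ, E) G} (hγt : γ t ∈ (extChartAt 𝓘(ℝ, E) x₀).source)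
    (hcont : ContinuousAt γ t)
    (hγ : HasDerivAt (fun s => extChartAt 𝓘(ℝ, E) x₀ (γ s))
      (frameDeriv E (extChartAt 𝓘(ℝ, E) x₀) (γ t) w) t) :
    HasMFDerivAt 𝓘(ℝ, ℝ) 𝓘(ℝ, E) γ t
      ((1 : ℝ →L[ℝ] ℝ).smulRight (mulInvariantVectorField w (γ t))) := by
  set χ := extChartAt 𝓘(ℝ, E) x₀
  have hs : MDifferentiableAt 𝓘(ℝ, E) 𝓘(ℝ, E) χ.symm (χ (γ t)) :=
    (contMDiffAt_symm_extChartAt_of_mem (χ.map_source hγt)).mdifferentiableAt (by simp)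
  have hc : MDifferentiableAt 𝓘(ℝ, E) 𝓘(ℝ, E) χ (γ t) :=
    (contMDiffAt_extChartAt_of_mem hγt).mdifferentiableAt (by simp)
  have h1 := hs.hasMFDerivAt.comp t hγ.hasFDerivAt.hasMFDerivAt
  have h2 : HasMFDerivAt 𝓘(ℝ, ℝ) 𝓘(ℝ, E) γ t _ := h1.congr_of_eventuallyEq (by
    filter_upwards [hcont.eventually_mem
      ((isOpen_extChartAt_source (I := 𝓘(ℝ, E)) x₀).mem_nhds hγt)] with s hs
    exact (χ.left_inv hs).symm)
  have h3 : (mfderiv 𝓘(ℝ, E) 𝓘(ℝ, E) χ.symm (χ (γ t))).comp (mfderiv 𝓘(ℝ, E) 𝓘(ℝ, E) χ (γ t)) =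
      ContinuousLinearMap.id ℝ E := by
    refine hasMFDerivAt_unique (hs.hasMFDerivAt.comp (γ t) hc.hasMFDerivAt)
      ((hasMFDerivAt_id (γ t)).congr_of_eventuallyEq ?_)
    filter_upwards [(isOpen_extChartAt_source (I := 𝓘(ℝ, E)) x₀).mem_nhds hγt] with y hy
    exact χ.left_inv hy
  have h4 := frameDeriv_eq_of_hasMFDerivAt hc.hasMFDerivAt w
  refine h2.congr_mfderiv ?_
  ext
  have h5 := congrArg (fun L : E →L[ℝ] E => L (mulInvariantVectorField w (γ t))) h3
  have h6 : (mfderiv 𝓘(ℝ, E) 𝓘(ℝ, E) χ.symm (χ (γ t)) : E →L[ℝ] E)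
      (frameDeriv E χ (γ t) w) = (mulInvariantVectorField w (γ t) : E) :=
    (congrArg (fun z : E => (mfderiv 𝓘(ℝ, E) 𝓘(ℝ, E) χ.symm (χ (γ t)) : E →L[ℝ] E) z) h4).trans h5
  refine Eq.trans (congrArg (fun z : E => (mfderiv 𝓘(ℝ, E) 𝓘(ℝ, E) χ.symm (χ (γ t)) : E →L[ℝ] E) z)
    (one_smul ℝ (frameDeriv E χ (γ t) w))) (h6.trans (one_smul ℝ _).symm)

end Frame

/-! ### Left invariant fields under translations and homomorphisms -/

section InvariantFields

variable {E : Type*} [NormedAddCommGroup E] [NormedSpace ℝ E]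
  {G : Type*} [TopologicalSpace G] [ChartedSpace E G] [Group G] [LieGroup 𝓘(ℝ, E) ∞ G]
  {E' : Type*} [NormedAddCommGroup E'] [NormedSpace ℝ E']
  {H : Type*} [TopologicalSpace H] [ChartedSpace E' H] [Group H] [LieGroup 𝓘(ℝ, E') ∞ H]

/-- A map `f` with `f (g * h) = f g * F h` sends left invariant fields to left invariant fields. -/
theorem mfderiv_mulInvariantVectorField_of_semiconj {f F : G → H}
    (hf : ContMDiff 𝓘(ℝ, E) 𝓘(ℝ, E') ∞ f) (hF : ContMDiff 𝓘(ℝ, E) 𝓘(ℝ, E') ∞ F) (hF1 : F 1 = 1)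
    (h : ∀ a b, f (a * b) = f a * F b) {w : GroupLieAlgebra 𝓘(ℝ, E') H}
    {v : GroupLieAlgebra 𝓘(ℝ, E) G} (hw : mfderiv 𝓘(ℝ, E) 𝓘(ℝ, E') F 1 v = w) (g : G) :
    mfderiv 𝓘(ℝ, E) 𝓘(ℝ, E') f g (mulInvariantVectorField v g) =
      mulInvariantVectorField w (f g) := by
  have e : f ∘ (g * ·) = (f g * ·) ∘ F := by ext b; exact h g b
  have hm : MDifferentiableAt 𝓘(ℝ, E) 𝓘(ℝ, E) (g * ·) (1 : G) :=
    (contMDiff_mul_left (I := 𝓘(ℝ, E)) (n := ∞) (a := g)).contMDiffAt.mdifferentiableAt (by simp)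
  have hm' : MDifferentiableAt 𝓘(ℝ, E') 𝓘(ℝ, E') (f g * ·) (F 1) :=
    (contMDiff_mul_left (I := 𝓘(ℝ, E')) (n := ∞) (a := f g)).contMDiffAt.mdifferentiableAt
      (by simp)
  have hfd : ∀ a, MDifferentiableAt 𝓘(ℝ, E) 𝓘(ℝ, E') f a := fun a =>
    hf.contMDiffAt.mdifferentiableAt (by simp)
  have hFd : MDifferentiableAt 𝓘(ℝ, E) 𝓘(ℝ, E') F 1 := hF.contMDiffAt.mdifferentiableAt (by simp)
  have h1 := mfderiv_comp (1 : G) (hfd (g * 1)) hm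
  have h2 := mfderiv_comp (1 : G) hm' hFd
  have h3 : (mfderiv 𝓘(ℝ, E) 𝓘(ℝ, E') (f ∘ (g * ·)) (1 : G) : E →L[ℝ] E') =
    (mfderiv 𝓘(ℝ, E) 𝓘(ℝ, E') ((f g * ·) ∘ F) (1 : G) : E →L[ℝ] E') := by rw [e]
  have h4 : (mfderiv 𝓘(ℝ, E) 𝓘(ℝ, E') f (g * 1) : E →L[ℝ] E') =
    (mfderiv 𝓘(ℝ, E) 𝓘(ℝ, E') f g : E →L[ℝ] E') := by rw [mul_one]
  have h5 : (mfderiv 𝓘(ℝ, E') 𝓘(ℝ, E') (f g * ·) (F 1) : E' →L[ℝ] E') =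
    (mfderiv 𝓘(ℝ, E') 𝓘(ℝ, E') (f g * ·) (1 : H) : E' →L[ℝ] E') := by rw [hF1]
  have h6 := (congrArg (fun L : E →L[ℝ] E' => L v) (h1.symm.trans (h3.trans h2)))
  have h7 : (mfderiv 𝓘(ℝ, E) 𝓘(ℝ, E') f (g * 1) : E →L[ℝ] E') (mulInvariantVectorField v g) =
    (mfderiv 𝓘(ℝ, E') 𝓘(ℝ, E') (f g * ·) (F 1) : E' →L[ℝ] E')
      (mfderiv 𝓘(ℝ, E) 𝓘(ℝ, E') F 1 v) := h6
  rw [h4, h5, hw] at h7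
  exact h7

/-- The pair `(f, F)` covers left translations (`F = id`) and homomorphisms (`f = F`) at once. -/
theorem HasMFDerivAt.comp_of_semiconj {f F : G → H}
    (hf : ContMDiff 𝓘(ℝ, E) 𝓘(ℝ, E') ∞ f) (hF : ContMDiff 𝓘(ℝ, E) 𝓘(ℝ, E') ∞ F) (hF1 : F 1 = 1)
    (h : ∀ a b, f (a * b) = f a * F b) {w : GroupLieAlgebra 𝓘(ℝ, E') H}
    {v : GroupLieAlgebra 𝓘(ℝ, E) G} (hw : mfderiv 𝓘(ℝ, E) 𝓘(ℝ, E') F 1 v = w) {γ : ℝ → G} {t : ℝ}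
    (hγ : HasMFDerivAt 𝓘(ℝ, ℝ) 𝓘(ℝ, E) γ t
      ((1 : ℝ →L[ℝ] ℝ).smulRight (mulInvariantVectorField v (γ t)))) :
    HasMFDerivAt 𝓘(ℝ, ℝ) 𝓘(ℝ, E') (fun s => f (γ s)) t
      ((1 : ℝ →L[ℝ] ℝ).smulRight (mulInvariantVectorField w (f (γ t)))) := by
  have h1 := (hf.contMDiffAt.mdifferentiableAt (by simp)).hasMFDerivAt.comp t hγ
  refine h1.congr_mfderiv ?_
  have h2 := mfderiv_mulInvariantVectorField_of_semiconj hf hF hF1 h hw (γ t)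
  refine ContinuousLinearMap.ext fun s : ℝ => ?_
  refine Eq.trans ((mfderiv 𝓘(ℝ, E) 𝓘(ℝ, E') f (γ t)).map_smul s _) ?_
  exact congrArg (fun z : E' => (s : ℝ) • z) h2

theorem HasMFDerivAt.mul_left_of_mulInvariant (a : G)
    {v : GroupLieAlgebra 𝓘(ℝ, E) G} {γ : ℝ → G} {t : ℝ}
    (hγ : HasMFDerivAt 𝓘(ℝ, ℝ) 𝓘(ℝ, E) γ t
      ((1 : ℝ →L[ℝ] ℝ).smulRight (mulInvariantVectorField v (γ t)))) :
    HasMFDerivAt 𝓘(ℝ, ℝ) 𝓘(ℝ, E) (fun s => a * γ s) t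
      ((1 : ℝ →L[ℝ] ℝ).smulRight (mulInvariantVectorField v (a * γ t))) :=
  hγ.comp_of_semiconj (f := (a * ·)) (F := id) contMDiff_mul_left contMDiff_id rfl
    (fun x y => (mul_assoc a x y).symm) (by rw [mfderiv_id]; rfl)

theorem HasMFDerivAt.map_monoidHom_of_mulInvariant {F : G →* H}
    (hF : ContMDiff 𝓘(ℝ, E) 𝓘(ℝ, E') ∞ F)  {w : GroupLieAlgebra 𝓘(ℝ, E') H}
    {v : GroupLieAlgebra 𝓘(ℝ, E) G} (hw : mfderiv 𝓘(ℝ, E) 𝓘(ℝ, E') F 1 v = w) {γ : ℝ → G} {t : ℝ}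
    (hγ : HasMFDerivAt 𝓘(ℝ, ℝ) 𝓘(ℝ, E) γ t
      ((1 : ℝ →L[ℝ] ℝ).smulRight (mulInvariantVectorField v (γ t)))) :
    HasMFDerivAt 𝓘(ℝ, ℝ) 𝓘(ℝ, E') (fun s => F (γ s)) t
      ((1 : ℝ →L[ℝ] ℝ).smulRight (mulInvariantVectorField w (F (γ t)))) :=
  hγ.comp_of_semiconj hF hF (map_one F) (map_mul F) hw

end InvariantFields

/-! ### The exponential map -/

section Exponential

variable {E : Type*} [NormedAddCommGroup E] [NormedSpace ℝ E]
  {G : Type*} [TopologicalSpace G] [ChartedSpace E G] [Group G] [LieGroup 𝓘(ℝ, E) ∞ G]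

variable (E G) in
theorem lieGroup_minSmoothness : LieGroup 𝓘(ℝ, E) (minSmoothness ℝ 3) G := by
  rw [minSmoothness_of_isRCLikeNormedField]
  infer_instance

theorem contMDiff_one_mulInvariantVectorField (v : GroupLieAlgebra 𝓘(ℝ, E) G) :
    ContMDiff 𝓘(ℝ, E) 𝓘(ℝ, E).tangent 1
      (fun g : G => (⟨g, mulInvariantVectorField v g⟩ : TangentBundle 𝓘(ℝ, E) G)) := by
  have := lieGroup_minSmoothness E G
  refine (contMDiff_mulInvariantVectorField v).of_le ?_
  rw [minSmoothness_of_isRCLikeNormedField]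
  exact one_le_two

/-- Left translation moves the local solution at `1` to every point with the same time of existence,
and a uniform time of existence gives completeness of the field. -/
theorem exists_isMIntegralCurve_mulInvariantVectorField [CompleteSpace E] [T2Space G]
    (v : GroupLieAlgebra 𝓘(ℝ, E) G) :
    ∃ γ : ℝ → G, γ 0 = 1 ∧ IsMIntegralCurve (I := 𝓘(ℝ, E)) γ (mulInvariantVectorField v) := by
  have hv := contMDiff_one_mulInvariantVectorField v
  obtain ⟨γ, hγ0, hγ⟩ := exists_isMIntegralCurveAt_of_contMDiffAt_boundaryless (I := 𝓘(ℝ, E)) 0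
    (hv.contMDiffAt (x := 1))
  rw [isMIntegralCurveAt_iff'] at hγ
  obtain ⟨ε, hε, h⟩ := hγ
  refine exists_isMIntegralCurve_of_isMIntegralCurveOn hv hε (fun x => ⟨fun s => x * γ s,
    by simp [hγ0], ?_⟩) 1
  rw [Real.ball_eq_Ioo] at h
  simp only [zero_sub, zero_add] at h
  intro t ht
  exact ((h t ht).hasMFDerivAt (isOpen_Ioo.mem_nhds ht)).mul_left_of_mulInvariant x
    |>.hasMFDerivWithinAt

variable [T2Space G]

/-- Uniqueness of integral curves on a Hausdorff manifold makes the choice in `lieExp` immaterial.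
-/
theorem lieExp_eq_of_isMIntegralCurve {v : GroupLieAlgebra 𝓘(ℝ, E) G} {γ : ℝ → G} (h0 : γ 0 = 1)
    (hγ : IsMIntegralCurve (I := 𝓘(ℝ, E)) γ (mulInvariantVectorField v)) : lieExp v = γ 1 := by
  have hex : ∃ g : G, ∃ γ : ℝ → G, γ 0 = 1 ∧
    IsMIntegralCurve (I := 𝓘(ℝ, E)) γ (mulInvariantVectorField v) ∧ γ 1 = g := ⟨_, γ, h0, hγ, rfl⟩
  obtain ⟨η, hη0, hη, h1⟩ := Classical.epsilon_spec hex
  have := isMIntegralCurve_Ioo_eq_of_contMDiff_boundaryless (t₀ := 0)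
    (contMDiff_one_mulInvariantVectorField v) hη hγ (hη0.trans h0.symm)
  rw [this] at h1
  exact h1.symm

theorem lieExp_smul_eq_of_isMIntegralCurve {v : GroupLieAlgebra 𝓘(ℝ, E) G} {γ : ℝ → G}
    (h0 : γ 0 = 1) (hγ : IsMIntegralCurve (I := 𝓘(ℝ, E)) γ (mulInvariantVectorField v)) (t : ℝ) :
    lieExp (t • v) = γ t := by
  have h := hγ.comp_mul t
  rw [← mulInvariantVectorField_smul] at h
  rw [lieExp_eq_of_isMIntegralCurve (by simpa using h0) h]
  simp

variable [CompleteSpace E]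

theorem isMIntegralCurve_lieExp_smul (v : GroupLieAlgebra 𝓘(ℝ, E) G) :
    IsMIntegralCurve (I := 𝓘(ℝ, E)) (fun t : ℝ => lieExp (t • v)) (mulInvariantVectorField v) := by
  obtain ⟨γ, h0, hγ⟩ := exists_isMIntegralCurve_mulInvariantVectorField v
  simpa only [lieExp_smul_eq_of_isMIntegralCurve h0 hγ] using hγ

theorem lieExp_zero : lieExp (0 : GroupLieAlgebra 𝓘(ℝ, E) G) = 1 := by
  obtain ⟨γ, h0, hγ⟩ :=
    exists_isMIntegralCurve_mulInvariantVectorField (0 : GroupLieAlgebra 𝓘(ℝ, E) G)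
  have := lieExp_smul_eq_of_isMIntegralCurve h0 hγ 0
  rwa [zero_smul, h0] at this

/-- As functions of `t`, both sides are integral curves of the same field and agree at `t = 0`. -/
theorem lieExp_add_smul (v : GroupLieAlgebra 𝓘(ℝ, E) G) (s t : ℝ) :
    lieExp ((s + t) • v) = lieExp (s • v) * lieExp (t • v) := by
  have h1 : IsMIntegralCurve (I := 𝓘(ℝ, E)) (fun t : ℝ => lieExp (s • v) * lieExp (t • v))
      (mulInvariantVectorField v) := fun t =>
    (isMIntegralCurve_lieExp_smul v t).mul_left_of_mulInvariant _
  have h2 := (isMIntegralCurve_lieExp_smul v).comp_add s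
  have h3 := isMIntegralCurve_Ioo_eq_of_contMDiff_boundaryless (t₀ := 0)
    (contMDiff_one_mulInvariantVectorField v) h2 h1 (by simp [lieExp_zero])
  have h4 := congrFun h3 t
  simpa [add_comm] using h4

theorem map_lieExp {E' : Type*} [NormedAddCommGroup E'] [NormedSpace ℝ E'] [CompleteSpace E']
    {H : Type*} [TopologicalSpace H] [ChartedSpace E' H] [Group H] [LieGroup 𝓘(ℝ, E') ∞ H]
    [T2Space H] {F : G →* H} (hF : ContMDiff 𝓘(ℝ, E) 𝓘(ℝ, E') ∞ F)
    {w : GroupLieAlgebra 𝓘(ℝ, E') H} {v : GroupLieAlgebra 𝓘(ℝ, E) G}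
    (hw : mfderiv 𝓘(ℝ, E) 𝓘(ℝ, E') F 1 v = w) : F (lieExp v) = lieExp w := by
  have h : IsMIntegralCurve (I := 𝓘(ℝ, E')) (fun t : ℝ => F (lieExp (t • v)))
      (mulInvariantVectorField w) := fun t =>
    (isMIntegralCurve_lieExp_smul v t).map_monoidHom_of_mulInvariant hF hw
  have := lieExp_eq_of_isMIntegralCurve (by simp [lieExp_zero]) h
  simpa using this.symm

end Exponential

/-! ### Homomorphisms to the real line -/

section AdditiveFunctions

variable {E : Type*} [NormedAddCommGroup E] [NormedSpace ℝ E]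
  {G : Type*} [TopologicalSpace G] [ChartedSpace E G] [Group G]

theorem frameDeriv_eq_frameDeriv_one {p : G → ℝ} (hp : ∀ x y, p (x * y) = p x + p y) (g : G) :
    frameDeriv E p g = frameDeriv E p 1 := by
  simp only [frameDeriv, hp, fderiv_const_add]

theorem additive_lieExp [LieGroup 𝓘(ℝ, E) ∞ G] [CompleteSpace E] [T2Space G] {p : G → ℝ}
    (hp : ∀ x y, p (x * y) = p x + p y) (hs : ContMDiff 𝓘(ℝ, E) 𝓘(ℝ, ℝ) ∞ p)
    (v : GroupLieAlgebra 𝓘(ℝ, E) G) : p (lieExp v) = frameDeriv E p 1 v := by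
  have h1 : p 1 = 0 := by simpa using hp 1 1
  have h : ∀ t : ℝ, HasDerivAt (fun s => p (lieExp (s • v)) - s * frameDeriv E p 1 v) 0 t := by
    intro t
    have h2 := (isMIntegralCurve_lieExp_smul v t).hasDerivAt_comp_of_mulInvariant (φ := p)
      hs.contMDiffAt
    rw [frameDeriv_eq_frameDeriv_one hp] at h2
    exact (h2.sub ((hasDerivAt_id t).mul_const (frameDeriv E p 1 v))).congr_deriv (by simp)
  have h3 := is_const_of_deriv_eq_zero (fun t => (h t).differentiableAt) (fun t => (h t).deriv) 1 0
  simp [lieExp_zero, h1] at h3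
  linarith

end AdditiveFunctions

/-! ### Lie brackets and closed left invariant one-forms -/

section LieBracket

variable {E : Type*} [NormedAddCommGroup E] [NormedSpace ℝ E]
  {G : Type*} [TopologicalSpace G] [ChartedSpace E G] [Group G] [LieGroup 𝓘(ℝ, E) ∞ G]

/-- If the one-form `η` is constant on the fields `V` and `W`, then its exterior derivative is
evaluated on them by the Lie bracket. -/
theorem fderiv_sub_fderiv_swap_eq_neg_lieBracket {η : E → E →L[ℝ] ℝ} {V W : E → E} {x : E}
    (hη : DifferentiableAt ℝ η x) (hV : DifferentiableAt ℝ V x) (hW : DifferentiableAt ℝ W x)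
    {a b : ℝ} (ha : ∀ᶠ y in nhds x, η y (V y) = a) (hb : ∀ᶠ y in nhds x, η y (W y) = b) :
    fderiv ℝ η x (V x) (W x) - fderiv ℝ η x (W x) (V x) =
      - η x (VectorField.lieBracket ℝ V W x) := by
  have h1 := (hη.hasFDerivAt.clm_apply hV.hasFDerivAt).unique
    ((hasFDerivAt_const a x).congr_of_eventuallyEq ha)
  have h2 := (hη.hasFDerivAt.clm_apply hW.hasFDerivAt).unique
    ((hasFDerivAt_const b x).congr_of_eventuallyEq hb)
  have h3 := congrArg (fun L : E →L[ℝ] ℝ => L (W x)) h1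
  have h4 := congrArg (fun L : E →L[ℝ] ℝ => L (V x)) h2
  simp at h3 h4
  rw [VectorField.lieBracket_eq, map_sub]
  linarith

theorem contDiffAt_frameDeriv_extChartAt {x₀ : G} {x : E}
    (hx : x ∈ (extChartAt 𝓘(ℝ, E) x₀).target) :
    ContDiffAt ℝ ∞ (fun y => frameDeriv E (extChartAt 𝓘(ℝ, E) x₀)
      ((extChartAt 𝓘(ℝ, E) x₀).symm y)) x :=
  contDiffAt_frameDeriv hx (contMDiffAt_extChartAt_of_mem ((extChartAt 𝓘(ℝ, E) x₀).map_target hx))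

/-- Functions with the same frame derivatives differ by a local constant. -/
theorem eventually_sub_eq_of_frameDeriv_eq {q₁ q₂ : G → ℝ} {g₀ : G}
    (h : ∀ᶠ g in nhds g₀, ContMDiffAt 𝓘(ℝ, E) 𝓘(ℝ, ℝ) ∞ q₁ g ∧ ContMDiffAt 𝓘(ℝ, E) 𝓘(ℝ, ℝ) ∞ q₂ g ∧
      frameDeriv E q₁ g = frameDeriv E q₂ g) :
    ∀ᶠ g in nhds g₀, q₁ g - q₂ g = q₁ g₀ - q₂ g₀ := by
  set χ := extChartAt 𝓘(ℝ, E) g₀ with hχ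
  have hsymm : Filter.Tendsto χ.symm (nhds (χ g₀)) (nhds g₀) := by
    have := (continuousAt_extChartAt_symm (I := 𝓘(ℝ, E)) g₀).tendsto
    rwa [extChartAt_to_inv] at this
  obtain ⟨ε, hε, hball⟩ := Metric.mem_nhds_iff.1
    (Filter.inter_mem (hsymm h) (extChartAt_target_mem_nhds (I := 𝓘(ℝ, E)) g₀))
  set d : E → ℝ := fun y => q₁ (χ.symm y) - q₂ (χ.symm y) with hd
  have hder : ∀ y ∈ Metric.ball (χ g₀) ε, HasFDerivAt d (0 : E →L[ℝ] ℝ) y := by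
    intro y hy
    obtain ⟨⟨h1, h2, h3⟩, hyt⟩ := hball hy
    have d1 := ((h1.comp y (contMDiffAt_symm_extChartAt_of_mem hyt)).contDiffAt.differentiableAt
      (by simp)).hasFDerivAt
    have d2 := ((h2.comp y (contMDiffAt_symm_extChartAt_of_mem hyt)).contDiffAt.differentiableAt
      (by simp)).hasFDerivAt
    rw [← χ.right_inv hyt] at d1 d2
    have e1 := frameDeriv_eq_comp (χ.map_target hyt) d1
    have e2 := frameDeriv_eq_comp (χ.map_target hyt) d2
    rw [χ.right_inv hyt] at d1 d2
    refine (d1.sub d2).congr_fderiv (sub_eq_zero.2 ?_)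
    rw [h3, e2] at e1
    -- Cancelling the invertible frame turns equal frame derivatives into equal derivatives in the
    -- chart.
    obtain ⟨e, he⟩ := isInvertible_frameDeriv_extChartAt (χ.map_target hyt)
    rw [← he] at e1
    ext u
    have := congrArg (fun L : E →L[ℝ] ℝ => L (e.symm u)) e1
    simp only [ContinuousLinearMap.comp_apply, ContinuousLinearEquiv.coe_coe,
      ContinuousLinearEquiv.apply_symm_apply, χ.right_inv hyt] at this
    exact this.symm
  have hconst : ∀ y ∈ Metric.ball (χ g₀) ε, d y = d (χ g₀) := fun y hy =>
    Metric.isOpen_ball.is_const_of_fderiv_eq_zero (convex_ball _ _).isPreconnected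
      (fun z hz => (hder z hz).differentiableAt.differentiableWithinAt)
      (fun z hz => (hder z hz).fderiv) hy (Metric.mem_ball_self hε)
  filter_upwards [(continuousAt_extChartAt (I := 𝓘(ℝ, E)) g₀).eventually_mem
    (Metric.ball_mem_nhds _ hε), extChartAt_source_mem_nhds (I := 𝓘(ℝ, E)) g₀] with g hg hgs
  have := hconst _ hg
  simp only [hd, ← hχ, χ.left_inv hgs] at this
  rwa [hχ, extChartAt_to_inv] at this

variable [CompleteSpace E]

/-- The Lie bracket of left invariant fields, computed in a chart. -/
theorem lieBracket_frameDeriv_extChartAt {x₀ : G} {x : E}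
    (hx : x ∈ (extChartAt 𝓘(ℝ, E) x₀).target) (v w : GroupLieAlgebra 𝓘(ℝ, E) G) :
    VectorField.lieBracket ℝ
      (fun y => frameDeriv E (extChartAt 𝓘(ℝ, E) x₀) ((extChartAt 𝓘(ℝ, E) x₀).symm y) v)
      (fun y => frameDeriv E (extChartAt 𝓘(ℝ, E) x₀) ((extChartAt 𝓘(ℝ, E) x₀).symm y) w) x =
      frameDeriv E (extChartAt 𝓘(ℝ, E) x₀) ((extChartAt 𝓘(ℝ, E) x₀).symm x) (⁅v, w⁆ : GroupLieAlgebra 𝓘(ℝ, E) G) := by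
  have := lieGroup_minSmoothness E G
  set χ := extChartAt 𝓘(ℝ, E) x₀ with hχ
  have hpull : ∀ X : Π g : G, TangentSpace 𝓘(ℝ, E) g, ∀ y ∈ χ.target,
      VectorField.mpullback 𝓘(ℝ, E) 𝓘(ℝ, E) χ.symm X y =
        (mfderiv 𝓘(ℝ, E) 𝓘(ℝ, E) χ (χ.symm y) : E →L[ℝ] E) (X (χ.symm y)) := by
    intro X y hy
    have h1 := mfderiv_extChartAt_comp_mfderivWithin_extChartAt_symm hy
    have h2 := mfderivWithin_extChartAt_symm_comp_mfderiv_extChartAt hy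
    simp only [ModelWithCorners.range_eq_univ, mfderivWithin_univ] at h1 h2
    rw [VectorField.mpullback_apply]
    exact congrArg (fun L : E →L[ℝ] E => L (X (χ.symm y))) (ContinuousLinearMap.inverse_eq h2 h1)
  have hpull' : ∀ u : GroupLieAlgebra 𝓘(ℝ, E) G, ∀ y ∈ χ.target,
      VectorField.mpullback 𝓘(ℝ, E) 𝓘(ℝ, E) χ.symm (mulInvariantVectorField u) y =
        frameDeriv E χ (χ.symm y) u := by
    intro u y hy
    have hc : MDifferentiableAt 𝓘(ℝ, E) 𝓘(ℝ, E) χ (χ.symm y) :=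
      (contMDiffAt_extChartAt_of_mem (χ.map_target hy)).mdifferentiableAt (by simp)
    exact (hpull _ y hy).trans (frameDeriv_eq_of_hasMFDerivAt hc.hasMFDerivAt u).symm
  have hnhds : χ.target ∈ nhds x := (isOpen_extChartAt_target (I := 𝓘(ℝ, E)) x₀).mem_nhds hx
  have h1 := VectorField.mpullback_mlieBracket (n := ∞) (I := 𝓘(ℝ, E)) (I' := 𝓘(ℝ, E))
    (f := χ.symm) (x₀ := x)
    (mdifferentiableAt_mulInvariantVectorField v) (mdifferentiableAt_mulInvariantVectorField w)
    (contMDiffAt_symm_extChartAt_of_mem hx) (by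
      rw [minSmoothness_of_isRCLikeNormedField]; exact ENat.LEInfty.out)
  rw [← mulInvariantVector_mlieBracket, hpull' _ x hx] at h1
  have h2 : ∀ V W : E → E, VectorField.mlieBracket 𝓘(ℝ, E) V W = VectorField.lieBracket ℝ V W := by
    intro V W
    exact (VectorField.mlieBracketWithin_univ (I := 𝓘(ℝ, E)) (V := V) (W := W)).symm.trans
      (VectorField.mlieBracketWithin_eq_lieBracketWithin.trans VectorField.lieBracketWithin_univ)
  rw [GroupLieAlgebra.bracket_def, h1]
  refine Eq.trans ?_ (congrFun (h2 _ _) x).symm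
  refine Filter.EventuallyEq.lieBracket_vectorField_eq ?_ ?_
  · filter_upwards [hnhds] with y hy using (hpull' v y hy).symm
  · filter_upwards [hnhds] with y hy using (hpull' w y hy).symm

/-- The differential of a homomorphism to `ℝ` vanishes on brackets. -/
theorem frameDeriv_one_bracket_eq_zero {p : G → ℝ} (hp : ∀ x y, p (x * y) = p x + p y)
    (hs : ContMDiff 𝓘(ℝ, E) 𝓘(ℝ, ℝ) ∞ p) (v w : GroupLieAlgebra 𝓘(ℝ, E) G) :
    frameDeriv E p (1 : G) (⁅v, w⁆ : GroupLieAlgebra 𝓘(ℝ, E) G) = 0 := by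
  set χ := extChartAt 𝓘(ℝ, E) (1 : G) with hχ
  set q : E → ℝ := fun y => p (χ.symm y) with hq
  set x := χ 1
  have hx : x ∈ χ.target := mem_extChartAt_target (1 : G)
  have hq_smooth : ∀ y ∈ χ.target, ContDiffAt ℝ ∞ q y := fun y hy =>
    (hs.contMDiffAt.comp y (contMDiffAt_symm_extChartAt_of_mem hy)).contDiffAt
  have hframe : ∀ u : E, ∀ y ∈ χ.target,
      fderiv ℝ q y (frameDeriv E χ (χ.symm y) u) = frameDeriv E p (1 : G) u := by
    intro u y hy
    have h1 := (hq_smooth y hy).differentiableAt (by simp)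
    have h2 := frameDeriv_eq_comp (φ := p) (χ.map_target hy) (D := fderiv ℝ q y)
      (by rw [← hχ, χ.right_inv hy]; exact h1.hasFDerivAt)
    rw [← frameDeriv_eq_frameDeriv_one hp (χ.symm y), h2]
    rfl
  have hnhds : χ.target ∈ nhds x := extChartAt_target_mem_nhds (1 : G)
  have hA := (contDiffAt_frameDeriv_extChartAt hx).differentiableAt (by simp)
  have h1 := fderiv_sub_fderiv_swap_eq_neg_lieBracket (x := x) (η := fderiv ℝ q)
    (V := fun y => frameDeriv E χ (χ.symm y) v) (W := fun y => frameDeriv E χ (χ.symm y) w)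
    (((hq_smooth x hx).fderiv_right (m := ∞) (by simp)).differentiableAt (by simp))
    (hA.clm_apply (differentiableAt_const _)) (hA.clm_apply (differentiableAt_const _))
    (Filter.eventually_of_mem hnhds (hframe v)) (Filter.eventually_of_mem hnhds (hframe w))
  have h2 : IsSymmSndFDerivAt ℝ q x := (hq_smooth x hx).isSymmSndFDerivAt (by
    rw [minSmoothness_of_isRCLikeNormedField]; exact ENat.LEInfty.out)
  have h3 := hframe (⁅v, w⁆ : GroupLieAlgebra 𝓘(ℝ, E) G) x hx
  have h4 := lieBracket_frameDeriv_extChartAt hx v w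
  -- Here `η = dq` is constant on both invariant fields. Symmetry of the second derivative says `dη
  -- = 0`, so `η` vanishes on their bracket.
  rw [h2.eq, sub_self] at h1
  exact h3.symm.trans ((congrArg (fderiv ℝ q x) h4.symm).trans (neg_eq_zero.1 h1.symm))

/-- A linear form that vanishes on brackets is the differential of a function near `1`. -/
theorem exists_local_primitive {l : E →L[ℝ] ℝ}
    (hl : ∀ v w : GroupLieAlgebra 𝓘(ℝ, E) G, l (⁅v, w⁆ : GroupLieAlgebra 𝓘(ℝ, E) G) = 0) :
    ∃ q : G → ℝ, ∃ U : Set G, IsOpen U ∧ (1 : G) ∈ U ∧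
      ∀ g ∈ U, ContMDiffAt 𝓘(ℝ, E) 𝓘(ℝ, ℝ) ∞ q g ∧ frameDeriv E q g = l := by
  set χ := extChartAt 𝓘(ℝ, E) (1 : G) with hχ
  set A : E → E →L[ℝ] E := fun y => frameDeriv E χ (χ.symm y) with hA
  -- The left invariant one-form with value `l` at the identity, written in the chart.
  set η : E → E →L[ℝ] ℝ := fun y => l.comp (A y).inverse with hη
  have hAinv : ∀ y ∈ χ.target, (A y).IsInvertible := fun y hy =>
    isInvertible_frameDeriv_extChartAt (χ.map_target hy)
  have hAs : ∀ y ∈ χ.target, ContDiffAt ℝ ∞ A y := fun y hy =>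
    contDiffAt_frameDeriv_extChartAt hy
  have hηs : ∀ y ∈ χ.target, ContDiffAt ℝ ∞ η y := by
    intro y hy
    obtain ⟨e, he⟩ := hAinv y hy
    have h1 : ContDiffAt ℝ ∞ (ContinuousLinearMap.inverse : (E →L[ℝ] E) → E →L[ℝ] E) (A y) := by
      rw [← he]; exact contDiffAt_map_inverse e
    exact contDiffAt_const.clm_comp (h1.comp y (hAs y hy))
  have hηA : ∀ y ∈ χ.target, ∀ u, η y (A y u) = l u := by
    intro y hy u
    obtain ⟨e, he⟩ := hAinv y hy
    simp [hη, ← he]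
  obtain ⟨ε, hε, hball⟩ := Metric.mem_nhds_iff.1 (extChartAt_target_mem_nhds (I := 𝓘(ℝ, E)) (1 : G))
  -- Poincaré lemma on a ball. Closedness at `y` need only be tested on values of invariant fields,
  -- which exhaust `E` because `A y` is invertible; there it reduces to `l` vanishing on brackets.
  obtain ⟨f, hf⟩ := (convex_ball (χ 1) ε).exists_forall_hasFDerivAt_of_fderiv_symmetric
    Metric.isOpen_ball
    (show DifferentiableOn ℝ η _ from fun y hy =>
      ((hηs y (hball hy)).differentiableAt (by simp)).differentiableWithinAt) (by
      intro y hy a b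
      obtain ⟨e, he⟩ := hAinv y (hball hy)
      have hyt : χ.target ∈ nhds y :=
        (isOpen_extChartAt_target (I := 𝓘(ℝ, E)) (1 : G)).mem_nhds (hball hy)
      have hAd := (hAs y (hball hy)).differentiableAt (by simp)
      obtain ⟨v, rfl⟩ : ∃ v : GroupLieAlgebra 𝓘(ℝ, E) G, A y v = a := ⟨e.symm a, by
        rw [← he]; exact e.apply_symm_apply a⟩
      obtain ⟨w, rfl⟩ : ∃ w : GroupLieAlgebra 𝓘(ℝ, E) G, A y w = b := ⟨e.symm b, by
        rw [← he]; exact e.apply_symm_apply b⟩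
      have h1 := fderiv_sub_fderiv_swap_eq_neg_lieBracket (x := y) (η := η)
        (V := fun z => A z v) (W := fun z => A z w)
        ((hηs y (hball hy)).differentiableAt (by simp))
        (hAd.clm_apply (differentiableAt_const _)) (hAd.clm_apply (differentiableAt_const _))
        (Filter.eventually_of_mem hyt fun z hz => hηA z hz _)
        (Filter.eventually_of_mem hyt fun z hz => hηA z hz _)
      have h2 := lieBracket_frameDeriv_extChartAt (hball hy) v w
      have h3 := hηA y (hball hy) (⁅v, w⁆ : GroupLieAlgebra 𝓘(ℝ, E) G)
      have h4 : η y (VectorField.lieBracket ℝ (fun z => A z v) (fun z => A z w) y) = 0 :=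
        (congrArg (η y) h2).trans (h3.trans (hl v w))
      rw [h4, neg_zero] at h1
      exact sub_eq_zero.1 h1)
  have hfs : ContDiffOn ℝ ∞ f (Metric.ball (χ 1) ε) := by
    rw [contDiffOn_infty_iff_fderiv_of_isOpen Metric.isOpen_ball]
    refine ⟨fun y hy => (hf y hy).differentiableAt.differentiableWithinAt, ?_⟩
    exact ContDiffOn.congr (fun y hy => (hηs y (hball hy)).contDiffWithinAt)
      (fun y hy => (hf y hy).fderiv)
  refine ⟨f ∘ χ, χ.source ∩ χ ⁻¹' Metric.ball (χ 1) ε,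
    (continuousOn_extChartAt (1 : G)).isOpen_inter_preimage (isOpen_extChartAt_source (1 : G))
      Metric.isOpen_ball, ⟨mem_extChartAt_source _, Metric.mem_ball_self hε⟩, ?_⟩
  rintro g ⟨hg, hgb⟩
  refine ⟨((hfs.contDiffAt (Metric.isOpen_ball.mem_nhds hgb)).contMDiffAt).comp g
    (contMDiffAt_extChartAt_of_mem hg), ?_⟩
  rw [frameDeriv_eq_comp (φ := f ∘ χ) hg (D := η (χ g)) ((hf _ hgb).congr_of_eventuallyEq ?_)]
  · ext u
    have := hηA _ (χ.map_source hg) u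
    simp only [hA, χ.left_inv hg] at this
    exact this
  · filter_upwards [(isOpen_extChartAt_target (I := 𝓘(ℝ, E)) (1 : G)).mem_nhds (χ.map_source hg)]
      with y hy
    exact congrArg f (χ.right_inv hy)

end LieBracket

/-! ### Monodromy: gluing local primitives -/

section Monodromy

/-- On a simply connected space, a family of local functions whose differences are locally constant
can be corrected by local constants to a global function. -/
theorem exists_global_of_sub_locally_constant {X : Type*} [TopologicalSpace X]
    [SimplyConnectedSpace X] [LocallyPathConnectedSpace X] {A : Type*} [AddCommGroup A]
    {U : X → Set X} (hU : ∀ i, IsOpen (U i)) (hmem : ∀ x, x ∈ U x) {q : X → X → A}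
    (hq : ∀ i j, ∀ x ∈ U i ∩ U j, ∀ᶠ y in nhds x, q i y - q j y = q i x - q j x) :
    ∃ p : X → A, ∀ i, ∀ x ∈ U i, ∀ᶠ y in nhds x, p y - q i y = p x - q i x := by
  let _ : TopologicalSpace A := ⊥
  have : DiscreteTopology A := ⟨rfl⟩
  -- With `A` discrete, the locally constant differences `q i - q j` are the transition functions of
  -- a covering space of `X`. Simple connectedness lifts the identity map to a global section.
  let Z : FiberBundleCore X X A :=
    { baseSet := U
      isOpen_baseSet := hU
      indexAt := id
      mem_baseSet_at := hmem
      coordChange := fun i j x v => v + (q i x - q j x)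
      coordChange_self := fun i x _ v => by simp
      continuousOn_coordChange := by
        intro i j
        rintro ⟨x, v⟩ ⟨hx, -⟩
        refine ContinuousAt.continuousWithinAt ?_
        have h1 : ∀ᶠ z : X × A in nhds (x, v), z.2 + (q i z.1 - q j z.1) =
            z.2 + (q i x - q j x) := by
          filter_upwards [continuousAt_fst.eventually (hq i j x hx)] with z hz
          rw [hz]
        have h2 : Continuous fun z : X × A => z.2 + (q i x - q j x) := by
          exact (continuous_of_discreteTopology (f := fun a : A => a + (q i x - q j x))).comp
            continuous_snd
        exact (h2.continuousAt).congr (Filter.EventuallyEq.symm h1)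
      coordChange_comp := fun i j k x _ v => by abel }
  have hcov : IsCoveringMap (Bundle.TotalSpace.proj : Bundle.TotalSpace A Z.Fiber → X) :=
    FiberBundle.isCoveringMap
  obtain ⟨x₀⟩ : Nonempty X := inferInstance
  obtain ⟨F, ⟨-, hF⟩, -⟩ := hcov.existsUnique_continuousMap_lifts (ContinuousMap.id X) x₀
    (⟨x₀, (0 : A)⟩ : Bundle.TotalSpace A Z.Fiber) rfl
  have hproj : ∀ x, (F x).proj = x := fun x => congrFun hF x
  let s : X → A := fun x => (F x).snd
  -- `s x` is the section read in the trivialization of index `x`. In the trivialization `i` the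
  -- section reads `p - q i`, which is continuous with discrete values, hence locally constant.
  refine ⟨fun x => s x + q x x, fun i x hx => ?_⟩
  have hcont : ContinuousAt (fun y => (Z.localTriv i (F y)).2) x := by
    refine continuousAt_snd.comp (ContinuousAt.comp ?_ F.continuous.continuousAt)
    refine (Z.localTriv i).continuousAt ?_
    rw [Bundle.Trivialization.mem_source]
    change (F x).proj ∈ U i
    rwa [hproj]
  have hval : ∀ y, (Z.localTriv i (F y)).2 = s y + (q y y - q i y) := by
    intro y
    have : (Z.localTriv i (F y)).2 =
      s y + (q (F y).proj (F y).proj - q i (F y).proj) := rfl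
    rw [this, hproj]
  have hconst : ∀ᶠ y in nhds x, (Z.localTriv i (F y)).2 = (Z.localTriv i (F x)).2 := by
    have := hcont.tendsto
    rw [nhds_discrete A, Filter.tendsto_pure] at this
    exact this
  filter_upwards [hconst] with y hy
  rw [hval, hval] at hy
  rw [add_sub_assoc, hy, ← add_sub_assoc]

end Monodromy

/-! ### Integrating a functional to a homomorphism -/

section LieIntegration

variable {E : Type*} [NormedAddCommGroup E] [NormedSpace ℝ E]
  {G : Type*} [TopologicalSpace G] [ChartedSpace E G] [Group G]

theorem frameDeriv_comp_mul_left (q : G → ℝ) (a g : G) :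
    frameDeriv E (fun h => q (a * h)) g = frameDeriv E q (a * g) := by
  simp only [frameDeriv, mul_assoc]

variable [LieGroup 𝓘(ℝ, E) ∞ G]

theorem frameDeriv_congr {q₁ q₂ : G → ℝ} {g : G} (h : q₁ =ᶠ[nhds g] q₂) :
    frameDeriv E q₁ g = frameDeriv E q₂ g :=
  Filter.EventuallyEq.fderiv_eq ((tendsto_mul_symm_extChartAt_one (E := E) g).eventually h)

/-- A linear form on the Lie algebra that vanishes on brackets is the differential of a
homomorphism to `ℝ`, if the group is simply connected. -/
theorem exists_additive_of_vanish_bracket [CompleteSpace E] [SimplyConnectedSpace G]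
    {l : E →L[ℝ] ℝ}
    (hl : ∀ v w : GroupLieAlgebra 𝓘(ℝ, E) G, l (⁅v, w⁆ : GroupLieAlgebra 𝓘(ℝ, E) G) = 0) :
    ∃ p : G → ℝ, ContMDiff 𝓘(ℝ, E) 𝓘(ℝ, ℝ) ∞ p ∧ (∀ x y, p (x * y) = p x + p y) ∧
      frameDeriv E p 1 = l := by
  have := ChartedSpace.locallyPathConnectedSpace (H := E) (M := G)
  obtain ⟨q, U, hU, h1U, hq⟩ := exists_local_primitive hl
  have hmul : ∀ a : G, Continuous (a * · : G → G) := fun a =>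
    (contMDiff_mul_left (I := 𝓘(ℝ, E)) (n := ∞) (a := a)).continuous
  have hq' : ∀ i x : G, i⁻¹ * x ∈ U →
      ContMDiffAt 𝓘(ℝ, E) 𝓘(ℝ, ℝ) ∞ (fun y => q (i⁻¹ * y)) x ∧
        frameDeriv E (fun y => q (i⁻¹ * y)) x = l := by
    intro i x hx
    refine ⟨(hq _ hx).1.comp x (contMDiff_mul_left (I := 𝓘(ℝ, E)) (n := ∞)).contMDiffAt, ?_⟩
    rw [frameDeriv_comp_mul_left]
    exact (hq _ hx).2
  have hUi : ∀ i : G, IsOpen {x : G | i⁻¹ * x ∈ U} := fun i => hU.preimage (hmul i⁻¹)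
  -- The left translates of the local primitive are primitives of the same invariant form, so their
  -- differences are locally constant.
  obtain ⟨p, hp⟩ := exists_global_of_sub_locally_constant (X := G) (A := ℝ)
    (U := fun i => {x | i⁻¹ * x ∈ U}) (q := fun i x => q (i⁻¹ * x)) hUi
    (fun x => by simpa using h1U) (by
      rintro i j x ⟨hi, hj⟩
      refine eventually_sub_eq_of_frameDeriv_eq (E := E) ?_
      filter_upwards [(hUi i).mem_nhds hi, (hUi j).mem_nhds hj] with y hyi hyj
      exact ⟨(hq' i y hyi).1, (hq' j y hyj).1, ((hq' i y hyi).2).trans (hq' j y hyj).2.symm⟩)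
  have hploc : ∀ x : G, ∀ᶠ y in nhds x, p y = q (x⁻¹ * y) + (p x - q 1) := by
    intro x
    filter_upwards [hp x x (by simpa using h1U)] with y hy
    simp only [inv_mul_cancel] at hy
    linarith
  -- Near `g * h` and near `h`, `p` is the same primitive `q` up to translation and a constant. So
  -- the difference is locally constant in `h`, and `G` is connected.
  have hadd : ∀ g h : G, p (g * h) - p h = p (g * 1) - p 1 := by
    intro g h
    have : IsLocallyConstant fun h => p (g * h) - p h := by
      rw [IsLocallyConstant.iff_eventually_eq]
      intro h
      filter_upwards [((hmul g).tendsto h).eventually (hploc (g * h)), hploc h] with y hy1 hy2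
      rw [hy1, hy2, show (g * h)⁻¹ * (g * y) = h⁻¹ * y by group]
      ring
    exact this.apply_eq_of_preconnectedSpace h 1
  refine ⟨fun x => p x - p 1, fun x => ?_, fun x y => ?_, ?_⟩
  · have h1 : ContMDiffAt 𝓘(ℝ, E) 𝓘(ℝ, ℝ) ∞ (fun y => q (x⁻¹ * y) + ((p x - q 1) - p 1)) x :=
      (contDiff_id.add contDiff_const).contMDiff.contMDiffAt.comp x
        (hq' x x (by simpa using h1U)).1
    refine h1.congr_of_eventuallyEq ?_
    filter_upwards [hploc x] with y hy
    rw [hy]; ring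
  · have := hadd x y
    rw [mul_one] at this
    linarith
  · rw [frameDeriv_congr (q₂ := fun y => q y + ((p 1 - q 1) - p 1))]
    · have := (hq 1 h1U).2
      simp only [frameDeriv, fderiv_add_const] at this ⊢
      exact this
    · filter_upwards [hploc 1] with y hy
      rw [hy]; simp; ring

end LieIntegration

/-! ### Generation of the group by one-parameter subgroups -/

section Generation

variable {E : Type*} [NormedAddCommGroup E] [NormedSpace ℝ E]
  {G : Type*} [TopologicalSpace G] [ChartedSpace E G] [Group G]

theorem frameDeriv_extChartAt_one :
    frameDeriv E (extChartAt 𝓘(ℝ, E) (1 : G)) 1 = .id ℝ E := by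
  refine HasFDerivAt.fderiv ((hasFDerivAt_id _).congr_of_eventuallyEq ?_)
  filter_upwards [extChartAt_target_mem_nhds (I := 𝓘(ℝ, E)) (1 : G)] with y hy
  rw [one_mul]
  exact (extChartAt 𝓘(ℝ, E) (1 : G)).right_inv hy

variable [LieGroup 𝓘(ℝ, E) ∞ G]

/-- The multiplication of `G` in the chart at the identity has derivative `(a, b) ↦ a + b`. -/
theorem hasStrictFDerivAt_mul_extChartAt_one :
    HasStrictFDerivAt (fun z : E × E => extChartAt 𝓘(ℝ, E) (1 : G)
      ((extChartAt 𝓘(ℝ, E) (1 : G)).symm z.1 * (extChartAt 𝓘(ℝ, E) (1 : G)).symm z.2))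
      (ContinuousLinearMap.fst ℝ E E + ContinuousLinearMap.snd ℝ E E)
      (extChartAt 𝓘(ℝ, E) (1 : G) 1, extChartAt 𝓘(ℝ, E) (1 : G) 1) := by
  set χ := extChartAt 𝓘(ℝ, E) (1 : G) with hχ
  have h1 : ContDiffAt ℝ ∞ (fun z : E × E => χ (χ.symm z.1 * χ.symm z.2)) (χ 1, χ 1) :=
    contDiffAt_comp_mul_symm (φ := χ) (mem_extChartAt_target (I := 𝓘(ℝ, E)) (1 : G))
      (contMDiffAt_extChartAt_of_mem ((extChartAt 𝓘(ℝ, E) (1 : G)).map_target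
        (mem_extChartAt_target (1 : G))))
  have h2 := h1.hasStrictFDerivAt (by simp)
  have hsymm1 : χ.symm (χ 1) = 1 := extChartAt_to_inv 1
  have hnhds : ∀ᶠ y in nhds (χ 1), y ∈ χ.target := extChartAt_target_mem_nhds (1 : G)
  set D := fderiv ℝ (fun z : E × E => χ (χ.symm z.1 * χ.symm z.2)) (χ 1, χ 1) with hD
  have e1 : D.comp (ContinuousLinearMap.inl ℝ E E) = .id ℝ E := by
    have := HasFDerivAt.comp (f := fun y => (y, χ 1)) (χ 1) h2.hasFDerivAt (hasFDerivAt_prodMk_left (𝕜 := ℝ) (χ 1) (χ 1))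
    refine this.unique ((hasFDerivAt_id _).congr_of_eventuallyEq ?_)
    filter_upwards [hnhds] with y hy
    simp only [Function.comp, hsymm1, mul_one, id]
    exact χ.right_inv hy
  have e2 : D.comp (ContinuousLinearMap.inr ℝ E E) = .id ℝ E := by
    have := HasFDerivAt.comp (f := fun y => (χ 1, y)) (χ 1) h2.hasFDerivAt (hasFDerivAt_prodMk_right (𝕜 := ℝ) (χ 1) (χ 1))
    refine this.unique ((hasFDerivAt_id _).congr_of_eventuallyEq ?_)
    filter_upwards [hnhds] with y hy
    simp only [Function.comp, hsymm1, one_mul, id]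
    exact χ.right_inv hy
  refine h2.congr_fderiv (ContinuousLinearMap.ext fun z => ?_)
  have e3 := congrArg (fun L : E →L[ℝ] E => L z.1) e1
  have e4 := congrArg (fun L : E →L[ℝ] E => L z.2) e2
  simp only [ContinuousLinearMap.comp_apply, ContinuousLinearMap.inl_apply,
    ContinuousLinearMap.inr_apply, ContinuousLinearMap.id_apply] at e3 e4
  have e5 : D z = D (z.1, 0) + D (0, z.2) := by rw [← map_add]; simp
  change D z = z.1 + z.2
  rw [e5, e3, e4]

variable [CompleteSpace E] [T2Space G]

/-- Strictness, needed for the inverse function theorem, comes from continuity of the derivative at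
`0`. -/
theorem hasStrictDerivAt_extChartAt_lieExp (v : GroupLieAlgebra 𝓘(ℝ, E) G) :
    HasStrictDerivAt (fun t : ℝ => extChartAt 𝓘(ℝ, E) (1 : G) (lieExp (t • v))) (v : E) 0 := by
  set χ := extChartAt 𝓘(ℝ, E) (1 : G) with hχ
  have hcont : Continuous fun t : ℝ => (lieExp (t • v) : G) :=
    (isMIntegralCurve_lieExp_smul v).continuous
  have h0 : (lieExp ((0 : ℝ) • v) : G) = 1 := by rw [zero_smul, lieExp_zero]
  have hd : ∀ᶠ t in nhds (0 : ℝ), HasDerivAt (fun t : ℝ => χ (lieExp (t • v)))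
      (frameDeriv E χ (lieExp (t • v)) v) t := by
    have : ∀ᶠ t in nhds (0 : ℝ), (lieExp (t • v) : G) ∈ χ.source :=
      hcont.continuousAt.eventually_mem (by rw [h0]; exact extChartAt_source_mem_nhds (1 : G))
    filter_upwards [this] with t ht
    exact (isMIntegralCurve_lieExp_smul v t).hasDerivAt_comp_of_mulInvariant
      (contMDiffAt_extChartAt_of_mem ht)
  have h1 : frameDeriv E χ (lieExp ((0 : ℝ) • v)) v = (v : E) := by
    rw [h0, frameDeriv_extChartAt_one]; rfl
  refine (hasStrictDerivAt_of_hasDerivAt_of_continuousAt hd ?_).congr_deriv h1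
  have h2 : ContinuousAt (frameDeriv E χ) (lieExp ((0 : ℝ) • v)) := by
    rw [h0]
    have h := (contDiffAt_frameDeriv_extChartAt (mem_extChartAt_target (I := 𝓘(ℝ, E))
      (1 : G))).continuousAt
    have h2 := h.comp (continuousAt_extChartAt (I := 𝓘(ℝ, E)) (1 : G))
    refine h2.congr ?_
    filter_upwards [extChartAt_source_mem_nhds (I := 𝓘(ℝ, E)) (1 : G)] with y hy
    exact congrArg (frameDeriv E χ) (χ.left_inv hy)
  exact (ContinuousAt.comp (f := fun t : ℝ => (lieExp (t • v) : G)) h2 hcont.continuousAt).clm_apply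
    continuousAt_const

/-- Multiplication has derivative `(a, b) ↦ a + b` at the identity, so the derivatives of the
factors add up. Continuity is carried through the induction to keep the partial products in the
chart domain. -/
theorem hasStrictFDerivAt_extChartAt_prod_lieExp
    (l : List ((E →L[ℝ] ℝ) × GroupLieAlgebra 𝓘(ℝ, E) G)) :
    Continuous (fun x : E => (l.map fun i => (lieExp (i.1 x • i.2) : G)).prod) ∧
    HasStrictFDerivAt (fun x : E => extChartAt 𝓘(ℝ, E) (1 : G)
      (l.map fun i => (lieExp (i.1 x • i.2) : G)).prod)
      (l.map fun i => i.1.smulRight (i.2 : E)).sum 0 := by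
  induction l with
  | nil =>
    simp only [List.map_nil, List.prod_nil, List.sum_nil]
    exact ⟨continuous_const, hasStrictFDerivAt_const _ _⟩
  | cons i l ih =>
    obtain ⟨ih1, ih2⟩ := ih
    have : IsTopologicalGroup G := topologicalGroup_of_lieGroup 𝓘(ℝ, E) ∞
    have hcont : Continuous fun x : E => (lieExp (i.1 x • i.2) : G) :=
      (isMIntegralCurve_lieExp_smul i.2).continuous.comp i.1.continuous
    simp only [List.map_cons, List.prod_cons, List.sum_cons]
    refine ⟨hcont.mul ih1, ?_⟩
    set χ := extChartAt 𝓘(ℝ, E) (1 : G) with hχ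
    have h0 : (lieExp (i.1 0 • i.2) : G) = 1 := by rw [map_zero, zero_smul, lieExp_zero]
    have h0' : (l.map fun i => (lieExp (i.1 0 • i.2) : G)).prod = 1 := by
      simp [lieExp_zero]
    have h1 : HasStrictFDerivAt (fun x : E => χ (lieExp (i.1 x • i.2)))
        (i.1.smulRight (i.2 : E)) 0 := by
      have h := hasStrictDerivAt_extChartAt_lieExp (G := G) i.2
      rw [← map_zero i.1] at h
      exact h.hasStrictFDerivAt.comp (0 : E) i.1.hasStrictFDerivAt
    have h2 := h1.prodMk ih2
    have h3 := hasStrictFDerivAt_mul_extChartAt_one (E := E) (G := G)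
    have h4 := HasStrictFDerivAt.comp (0 : E) (g := fun z : E × E => χ (χ.symm z.1 * χ.symm z.2))
      (by rw [h0, h0']; exact h3) h2
    have h5 := h4.congr_of_eventuallyEq (f₁ := fun x : E => χ (lieExp (i.1 x • i.2) *
      (l.map fun i => (lieExp (i.1 x • i.2) : G)).prod)) (by
        filter_upwards [hcont.continuousAt.eventually_mem (by
            rw [h0]; exact extChartAt_source_mem_nhds (I := 𝓘(ℝ, E)) (1 : G)),
          ih1.continuousAt.eventually_mem (by
            rw [h0']; exact extChartAt_source_mem_nhds (I := 𝓘(ℝ, E)) (1 : G))] with x hx hx'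
        rw [χ.left_inv hx, χ.left_inv hx'])
    exact h5.congr_fderiv (ContinuousLinearMap.ext fun x => rfl)

/-- A homomorphism to `ℝ` that vanishes on the one-parameter groups generated by a spanning set
vanishes identically. -/
theorem additive_eq_zero_of_lieExp [FiniteDimensional ℝ E] [PreconnectedSpace G] {M : G → ℝ}
    (hM : ∀ x y, M (x * y) = M x + M y) {s : Set (GroupLieAlgebra 𝓘(ℝ, E) G)}
    (hs : Submodule.span ℝ s = ⊤) (h : ∀ v ∈ s, ∀ t : ℝ, M (lieExp (t • v)) = 0) (g : G) :
    M g = 0 := by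
  have hM1 : M 1 = 0 := by simpa using hM 1 1
  have : FiniteDimensional ℝ (GroupLieAlgebra 𝓘(ℝ, E) G) := inferInstanceAs (FiniteDimensional ℝ E)
  set b := Module.Basis.ofSpan hs.ge with hb
  have hbs : ∀ i, b i ∈ s := fun i => Module.Basis.ofSpan_subset hs.ge ⟨i, rfl⟩
  have := Fintype.ofFinite ((linearIndepOn_empty ℝ id).extend (empty_subset s))
  set l : List ((E →L[ℝ] ℝ) × GroupLieAlgebra 𝓘(ℝ, E) G) := Finset.univ.toList.map fun i =>
    (LinearMap.toContinuousLinearMap (E := E) (F' := ℝ) (b.coord i), b i) with hl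
  obtain ⟨h1, h2⟩ := hasStrictFDerivAt_extChartAt_prod_lieExp l
  have h3 : (l.map fun i => i.1.smulRight (i.2 : E)).sum = .id ℝ E := by
    have key : ∀ (L : List _) (x : E), (((L.map fun i => ((LinearMap.toContinuousLinearMap (E := E)
        (F' := ℝ) (b.coord i), b i) : (E →L[ℝ] ℝ) × GroupLieAlgebra 𝓘(ℝ, E) G)).map
        fun i => i.1.smulRight (i.2 : E)).sum : E →L[ℝ] E) x =
        (L.map fun i => b.repr x i • b i).sum := by
      intro L x
      induction L with
      | nil => rfl
      | cons i L ih =>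
        simp only [List.map_cons, List.sum_cons]
        exact congrArg (fun z : E => @id E (b.repr x i • b i) + z) ih
    refine ContinuousLinearMap.ext fun x => (key _ x).trans ?_
    rw [Finset.sum_map_toList]
    exact b.sum_repr x
  set χ := extChartAt 𝓘(ℝ, E) (1 : G) with hχ
  set Φ : E → G := fun x => (l.map fun i => (lieExp (i.1 x • i.2) : G)).prod with hΦ
  have hΦ0 : Φ 0 = 1 := by simp [hΦ, lieExp_zero]
  have hMΦ : ∀ x, M (Φ x) = 0 := by
    intro x
    have key : ∀ L : List ((E →L[ℝ] ℝ) × GroupLieAlgebra 𝓘(ℝ, E) G), (∀ i ∈ L, i.2 ∈ s) →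
        M (L.map fun i => (lieExp (i.1 x • i.2) : G)).prod = 0 := by
      intro L
      induction L with
      | nil => intro _; exact hM1
      | cons i L ih =>
        intro hL
        rw [List.map_cons, List.prod_cons, hM, h _ (hL i (by simp)),
          ih fun j hj => hL j (by simp [hj]), add_zero]
    refine key l fun i hi => ?_
    obtain ⟨j, -, rfl⟩ := List.mem_map.1 hi
    exact hbs j
  -- `Φ` has derivative the identity in the chart, so it covers a neighbourhood of `1`. Thus `M`
  -- vanishes near `1`, although no continuity of `M` is assumed.
  have h4 := HasStrictFDerivAt.map_nhds_eq_of_equiv (f' := ContinuousLinearEquiv.refl ℝ E)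
    (h2.congr_fderiv h3)
  have h5 : ∀ᶠ y in nhds (χ 1), M (χ.symm y) = 0 := by
    have h40 : Filter.map (fun x => χ (Φ x)) (nhds 0) = nhds (χ (Φ 0)) := h4
    rw [hΦ0] at h40
    rw [← h40, Filter.eventually_map]
    filter_upwards [h1.continuousAt.eventually_mem (x := 0) (s := χ.source) (by
      rw [hΦ0]; exact extChartAt_source_mem_nhds (1 : G))] with x hx
    rw [χ.left_inv hx]
    exact hMΦ x
  have h6 : ∀ᶠ y in nhds (1 : G), M y = 0 := by
    filter_upwards [(continuousAt_extChartAt (I := 𝓘(ℝ, E)) (1 : G)).eventually h5,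
      extChartAt_source_mem_nhds (I := 𝓘(ℝ, E)) (1 : G)] with y hy hy'
    rwa [χ.left_inv hy'] at hy
  have h7 : IsLocallyConstant M := by
    rw [IsLocallyConstant.iff_eventually_eq]
    intro x
    have hc : Continuous (x⁻¹ * · : G → G) :=
      (contMDiff_mul_left (I := 𝓘(ℝ, E)) (n := ∞) (a := x⁻¹)).continuous
    have := hc.tendsto x
    rw [inv_mul_cancel] at this
    filter_upwards [this.eventually h6] with y hy
    have := hM x (x⁻¹ * y)
    rw [mul_inv_cancel_left] at this
    rw [this, hy, add_zero]
  rw [h7.apply_eq_of_preconnectedSpace g 1, hM1]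

end Generation

/-! ### Stratifications and `G`-linear functions -/

namespace Stratification

variable {E : Type*} [NormedAddCommGroup E] [NormedSpace ℝ E]
  {G : Type*} [TopologicalSpace G] [ChartedSpace E G] [Group G] (S : Stratification E G)

theorem iSup_layer : ⨆ i : Fin S.step, S.layer (i + 1) = ⊤ :=
  S.isInternal.submodule_iSup_eq_top

theorem induction_on_layers {P : GroupLieAlgebra 𝓘(ℝ, E) G → Prop}
    (h : ∀ i, 1 ≤ i → i ≤ S.step → ∀ v ∈ S.layer i, P v) (h0 : P 0)
    (hadd : ∀ v w, P v → P w → P (v + w)) (v : GroupLieAlgebra 𝓘(ℝ, E) G) : P v :=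
  Submodule.iSup_induction (fun i : Fin S.step => S.layer (i + 1)) (motive := P)
    (S.iSup_layer.ge (Submodule.mem_top (x := v)))
    (fun i v hv => h (i + 1) (by omega) (by omega) v hv) h0 hadd

theorem exists_linearMap (f : ∀ i : Fin S.step, S.layer (i + 1) →ₗ[ℝ] ℝ) :
    ∃ l : GroupLieAlgebra 𝓘(ℝ, E) G →ₗ[ℝ] ℝ, ∀ (i : Fin S.step) (v : S.layer (i + 1)), l v = f i v := by
  refine ⟨DirectSum.toModule ℝ (Fin S.step) ℝ f ∘ₗ
    (LinearEquiv.ofBijective (DirectSum.coeLinearMap fun i : Fin S.step => S.layer (i + 1))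
      S.isInternal).symm.toLinearMap, fun i v => ?_⟩
  have h : (LinearEquiv.ofBijective
      (DirectSum.coeLinearMap fun i : Fin S.step => S.layer (i + 1)) S.isInternal).symm v =
      DirectSum.lof ℝ (Fin S.step) (fun i : Fin S.step => S.layer (i + 1)) i v :=
    (LinearEquiv.symm_apply_eq _).2
      (DirectSum.coeLinearMap_lof (fun i : Fin S.step => S.layer (i + 1)) i v).symm
  exact (congrArg (DirectSum.toModule ℝ (Fin S.step) ℝ f) h).trans (by rw [DirectSum.toModule_lof])

/-- A functional on the horizontal layer extends by zero to the other layers. -/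
theorem exists_linearMap_horizontal (m : S.horizontal →ₗ[ℝ] ℝ) :
    ∃ l : GroupLieAlgebra 𝓘(ℝ, E) G →ₗ[ℝ] ℝ, (∀ v : S.horizontal, l v = m v) ∧
      ∀ i, 2 ≤ i → i ≤ S.step → ∀ v ∈ S.layer i, l v = 0 := by
  obtain ⟨l, hl⟩ := S.exists_linearMap fun i => if h : (i : ℕ) = 0 then
    m ∘ₗ Submodule.inclusion (h ▸ le_rfl : S.layer (i + 1) ≤ S.layer 1) else 0
  refine ⟨l, fun v => ?_, fun i h2 hi v hv => ?_⟩
  · have := hl ⟨0, S.step_pos⟩ v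
    rw [dif_pos rfl] at this
    exact this
  · obtain ⟨j, rfl⟩ : ∃ j, i = j + 1 := ⟨i - 1, by omega⟩
    have := hl ⟨j, by omega⟩ ⟨v, hv⟩
    rw [dif_neg (show ¬ j = 0 by omega)] at this
    exact this

variable {S}

theorem map_algDilation {l : GroupLieAlgebra 𝓘(ℝ, E) G →ₗ[ℝ] ℝ}
    (hl : ∀ i, 2 ≤ i → i ≤ S.step → ∀ v ∈ S.layer i, l v = 0) (c : ℝ)
    (v : GroupLieAlgebra 𝓘(ℝ, E) G) : l (S.algDilation c v) = c * l v := by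
  refine S.induction_on_layers (P := fun v => l (S.algDilation c v) = c * l v) ?_ (by simp) ?_ v
  · intro i h1 hi v hv
    obtain ⟨j, rfl⟩ : ∃ j, i = j + 1 := ⟨i - 1, by omega⟩
    rw [S.algDilation_apply_of_mem c ⟨j, by omega⟩ hv, map_smul, smul_eq_mul]
    rcases Nat.eq_zero_or_pos j with rfl | hj
    · simp
    · rw [hl (j + 1) (by omega) hi v hv]; simp
  · intro v w hv hw
    rw [map_add, map_add, hv, hw, map_add, mul_add]

theorem bracket_mem_layer (S : Stratification E G) {i : ℕ} (h1 : 1 ≤ i) (hi : i < S.step)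
    {x y : GroupLieAlgebra 𝓘(ℝ, E) G} (hx : x ∈ S.layer 1) (hy : y ∈ S.layer i) :
    ⁅x, y⁆ ∈ S.layer (i + 1) := by
  rw [S.layer_succ i h1 hi]
  exact Submodule.subset_span ⟨x, hx, y, hy, rfl⟩

/-- A functional that vanishes on the layers of index at least `2` vanishes on brackets. -/
theorem map_bracket [CompleteSpace E] [LieGroup 𝓘(ℝ, E) ∞ G]
    {l : GroupLieAlgebra 𝓘(ℝ, E) G →ₗ[ℝ] ℝ}
    (hl : ∀ i, 2 ≤ i → i ≤ S.step → ∀ v ∈ S.layer i, l v = 0)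
    (v w : GroupLieAlgebra 𝓘(ℝ, E) G) : l ⁅v, w⁆ = 0 := by
  have := lieGroup_minSmoothness E G
  have base : ∀ x ∈ S.layer 1, ∀ z, l ⁅x, z⁆ = 0 := by
    intro x hx z
    refine S.induction_on_layers (P := fun z => l ⁅x, z⁆ = 0) ?_ ?_ ?_ z
    · intro i h1 hi y hy
      rcases hi.lt_or_eq with hlt | rfl
      · exact hl (i + 1) (by omega) hlt _ (S.bracket_mem_layer h1 hlt hx hy)
      · rw [S.bracket_layer_step x hx y hy, map_zero]
    · rw [lie_zero, map_zero]
    · intro y z hy hz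
      rw [lie_add, map_add, hy, hz, add_zero]
  -- Induction by the Jacobi identity `⁅⁅x, y⁆, z⁆ = ⁅x, ⁅y, z⁆⁆ - ⁅y, ⁅x, z⁆⁆` with `x` horizontal:
  -- `base` kills the first term, the induction hypothesis the second.
  have step : ∀ i, 1 ≤ i → i ≤ S.step → ∀ y ∈ S.layer i, ∀ z, l ⁅y, z⁆ = 0 := by
    intro i h1
    induction i, h1 using Nat.le_induction with
    | base => exact fun _ => base
    | succ i h1 ih =>
      intro hi y hy z
      rw [S.layer_succ i h1 hi] at hy
      induction hy using Submodule.span_induction with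
      | mem y hy =>
        obtain ⟨x, hx, y', hy', rfl⟩ := hy
        rw [lie_lie, map_sub, base x hx, ih (by omega) y' hy', sub_zero]
      | zero => rw [zero_lie, map_zero]
      | add a b _ _ ha hb => rw [add_lie, map_add, ha, hb, add_zero]
      | smul c a _ ha => rw [smul_lie, map_smul, ha, smul_zero]
  refine S.induction_on_layers (P := fun v => l ⁅v, w⁆ = 0)
    (fun i h1 hi v hv => step i h1 hi v hv w) (by rw [zero_lie, map_zero]) (fun a b ha hb => ?_) v
  rw [add_lie, map_add, ha, hb, add_zero]

/-- A smooth homomorphism to `ℝ` has a derivative that vanishes on the layers of index at least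
`2`. -/
theorem frameDeriv_one_eq_zero_of_mem_layer [CompleteSpace E] [LieGroup 𝓘(ℝ, E) ∞ G]
    (S : Stratification E G) {p : G → ℝ} (hp : ∀ x y, p (x * y) = p x + p y)
    (hs : ContMDiff 𝓘(ℝ, E) 𝓘(ℝ, ℝ) ∞ p) {i : ℕ} (h2 : 2 ≤ i) (hi : i ≤ S.step)
    {v : GroupLieAlgebra 𝓘(ℝ, E) G} (hv : v ∈ S.layer i) : frameDeriv E p 1 v = 0 := by
  obtain ⟨j, rfl⟩ : ∃ j, i = j + 1 := ⟨i - 1, by omega⟩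
  rw [S.layer_succ j (by omega) hi] at hv
  induction hv using Submodule.span_induction with
  | mem y hy =>
    obtain ⟨x, -, y', -, rfl⟩ := hy
    exact frameDeriv_one_bracket_eq_zero hp hs x y'
  | zero => exact map_zero (frameDeriv E p 1)
  | add a b _ _ ha hb =>
    exact (map_add (frameDeriv E p 1) (a : E) b).trans ((congrArg₂ (· + ·) ha hb).trans (add_zero 0))
  | smul c a _ ha =>
    exact (map_smul (frameDeriv E p 1) c (a : E)).trans ((congrArg (c • ·) ha).trans (smul_zero c))

theorem lieExp_natCast_smul [CompleteSpace E] [LieGroup 𝓘(ℝ, E) ∞ G] [T2Space G]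
    (v : GroupLieAlgebra 𝓘(ℝ, E) G) (n : ℕ) : lieExp ((n : ℝ) • v) = lieExp v ^ n := by
  induction n with
  | zero => rw [Nat.cast_zero, zero_smul, lieExp_zero, pow_zero]
  | succ n ih =>
    rw [Nat.cast_succ, lieExp_add_smul, ih, one_smul, pow_succ]

/-- A `G`-linear function vanishes on the exponentials of the layers of index at least `2`. -/
theorem _root_.IsGLinear.lieExp_eq_zero [CompleteSpace E] [LieGroup 𝓘(ℝ, E) ∞ G] [T2Space G]
    {L : G → ℝ} (hL : IsGLinear S L) {i : ℕ} (h2 : 2 ≤ i) (hi : i ≤ S.step)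
    {v : GroupLieAlgebra 𝓘(ℝ, E) G} (hv : v ∈ S.layer i) : L (lieExp v) = 0 := by
  obtain ⟨j, rfl⟩ : ∃ j, i = j + 1 := ⟨i - 1, by omega⟩
  -- With `c = 2` the dilation multiplies `v` by the integer `2 ^ i`. Hence `L (lieExp (2 ^ i • v))`
  -- is `2 * L (lieExp v)` by homogeneity and `2 ^ i * L (lieExp v)` by additivity alone.
  have h := hL.2 2 two_pos v
  have hpow : ∀ (g : G) (n : ℕ), L (g ^ n) = n * L g := by
    intro g n
    induction n with
    | zero => have := hL.1 1 1; simp at this; simp [this]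
    | succ n ih => rw [pow_succ, hL.1, ih]; push_cast; ring
  rw [S.algDilation_apply_of_mem 2 ⟨j, by omega⟩ hv] at h
  have h3 : ((2 : ℝ) ^ (j + 1)) = ((2 ^ (j + 1) : ℕ) : ℝ) := by push_cast; rfl
  have h4 := lieExp_natCast_smul v (2 ^ (j + 1))
  change L (lieExp ((2 : ℝ) ^ (j + 1) • v)) = _ at h
  rw [h3, h4, hpow] at h
  have h5 : (2 : ℝ) ^ 2 ≤ 2 ^ (j + 1) := pow_le_pow_right₀ (by norm_num) h2
  push_cast at h
  by_contra hne
  have := mul_right_cancel₀ hne h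
  linarith

/-- A `G`-linear function is homogeneous on the exponentials of horizontal vectors. -/
theorem _root_.IsGLinear.lieExp_smul [CompleteSpace E] [LieGroup 𝓘(ℝ, E) ∞ G] [T2Space G]
    {L : G → ℝ} (hL : IsGLinear S L) {v : GroupLieAlgebra 𝓘(ℝ, E) G} (hv : v ∈ S.layer 1)
    (c : ℝ) : L (lieExp (c • v)) = c * L (lieExp v) := by
  have h1 : L 1 = 0 := by simpa using hL.1 1 1
  have hpos : ∀ c : ℝ, 0 < c → L (lieExp (c • v)) = c * L (lieExp v) := by
    intro c hc
    have h := hL.2 c hc v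
    rw [S.algDilation_apply_of_mem c ⟨0, S.step_pos⟩ hv] at h
    simpa using h
  rcases lt_trichotomy c 0 with hc | rfl | hc
  · have h2 := lieExp_add_smul v c (-c)
    rw [add_neg_cancel, zero_smul, lieExp_zero] at h2
    have h3 := hL.1 (lieExp (c • v)) (lieExp (-c • v))
    rw [← h2, h1, hpos (-c) (by linarith)] at h3
    linarith
  · rw [zero_smul, lieExp_zero, h1, zero_mul]
  · exact hpos c hc

end Stratification

/-! ### Horizontal curves and their controls -/

theorem ContinuousOn.integrableOn_clm_apply {V W : Type*} [NormedAddCommGroup V] [NormedSpace ℝ V]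
    [NormedAddCommGroup W] [NormedSpace ℝ W] {a b : ℝ} {A : ℝ → V →L[ℝ] W} {u : ℝ → V}
    (hA : ContinuousOn A (Icc a b)) (hu : IntegrableOn u (Icc a b)) :
    IntegrableOn (fun t => A t (u t)) (Icc a b) := by
  obtain ⟨C, hC⟩ := isCompact_Icc.exists_bound_of_continuousOn hA
  refine Integrable.mono' (hu.norm.const_mul C) ?_ ?_
  · exact (ContinuousLinearMap.id ℝ (V →L[ℝ] W)).aestronglyMeasurable_comp₂
      (hA.aestronglyMeasurable_of_isCompact isCompact_Icc measurableSet_Icc)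
      hu.aestronglyMeasurable
  · filter_upwards [ae_restrict_mem measurableSet_Icc] with t ht
    exact (A t).le_of_opNorm_le (hC t ht) (u t)

section HorizontalVector

variable {E : Type*} [NormedAddCommGroup E] [NormedSpace ℝ E]
  {G : Type*} [TopologicalSpace G] [ChartedSpace E G] [Group G] {r : ℕ}

/-- The element `∑ uⱼ Xⱼ` of the Lie algebra. -/
def horizontalVector (X : Fin r → GroupLieAlgebra 𝓘(ℝ, E) G) : EuclideanSpace ℝ (Fin r) →L[ℝ] E :=
  ∑ j, (EuclideanSpace.proj j : EuclideanSpace ℝ (Fin r) →L[ℝ] ℝ).smulRight (X j : E)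

theorem horizontalVector_apply (X : Fin r → GroupLieAlgebra 𝓘(ℝ, E) G)
    (u : EuclideanSpace ℝ (Fin r)) :
    (horizontalVector X u : GroupLieAlgebra 𝓘(ℝ, E) G) = ∑ j, u j • X j := by
  refine (_root_.sum_apply _ _ _).trans rfl

theorem sum_smul_mulInvariantVectorField (X : Fin r → GroupLieAlgebra 𝓘(ℝ, E) G)
    (u : EuclideanSpace ℝ (Fin r)) (g : G) :
    ∑ j, u j • mulInvariantVectorField (X j) g =
      mulInvariantVectorField (horizontalVector X u : GroupLieAlgebra 𝓘(ℝ, E) G) g := by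
  rw [mulInvariantVectorField_sum_smul Finset.univ (fun j => u j) X g, horizontalVector_apply]

end HorizontalVector

namespace IsHorizontalCurve

variable {E : Type*} [NormedAddCommGroup E] [NormedSpace ℝ E]
  {G : Type*} [TopologicalSpace G] [ChartedSpace E G] [Group G] {r : ℕ}
  {X : Fin r → GroupLieAlgebra 𝓘(ℝ, E) G} {a b : ℝ} {γ : ℝ → G} {u : ℝ → EuclideanSpace ℝ (Fin r)}

theorem ae_hasMFDerivAt (h : IsHorizontalCurve X a b γ u) :
    ∀ᵐ t ∂(volume.restrict (Icc a b)), HasMFDerivAt 𝓘(ℝ, ℝ) 𝓘(ℝ, E) γ t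
      ((1 : ℝ →L[ℝ] ℝ).smulRight (mulInvariantVectorField
        (horizontalVector X (u t) : GroupLieAlgebra 𝓘(ℝ, E) G) (γ t))) := by
  filter_upwards [h.2.2] with t ht
  rwa [sum_smul_mulInvariantVectorField] at ht

theorem of_ae_hasMFDerivAt (hγ : AbsContCurve E γ a b) (hu : IntegrableOn u (Icc a b))
    (h : ∀ᵐ t ∂(volume.restrict (Icc a b)), HasMFDerivAt 𝓘(ℝ, ℝ) 𝓘(ℝ, E) γ t
      ((1 : ℝ →L[ℝ] ℝ).smulRight (mulInvariantVectorField
        (horizontalVector X (u t) : GroupLieAlgebra 𝓘(ℝ, E) G) (γ t)))) :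
    IsHorizontalCurve X a b γ u := by
  refine ⟨hγ, hu, ?_⟩
  filter_upwards [h] with t ht
  rwa [← sum_smul_mulInvariantVectorField] at ht

theorem mono (h : IsHorizontalCurve X a b γ u) {c d : ℝ} (hcd : c ≤ d) (hac : a ≤ c) (hdb : d ≤ b) :
    IsHorizontalCurve X c d γ u := by
  have hsub := Icc_subset_Icc hac hdb
  refine ⟨⟨h.1.1.mono hsub, fun φ hφ => (h.1.2 φ hφ).mono ?_⟩, h.2.1.mono_set hsub,
    ae_restrict_of_ae_restrict_of_subset hsub h.2.2⟩
  rwa [uIcc_of_le hcd, uIcc_of_le (hac.trans (hcd.trans hdb))]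

variable [LieGroup 𝓘(ℝ, E) ∞ G]

/-- The differential of `F` at the identity takes `∑ uⱼ Xⱼ` to `∑ uⱼ Yⱼ`, so the controls, and with
them the length, are unchanged. -/
theorem comp_of_semiconj {E' : Type*} [NormedAddCommGroup E'] [NormedSpace ℝ E']
    {H : Type*} [TopologicalSpace H] [ChartedSpace E' H] [Group H] [LieGroup 𝓘(ℝ, E') ∞ H]
    {Y : Fin r → GroupLieAlgebra 𝓘(ℝ, E') H} {f F : G → H}
    (hf : ContMDiff 𝓘(ℝ, E) 𝓘(ℝ, E') ∞ f) (hF : ContMDiff 𝓘(ℝ, E) 𝓘(ℝ, E') ∞ F) (hF1 : F 1 = 1)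
    (hfF : ∀ a b, f (a * b) = f a * F b)
    (hFX : ∀ i, mfderiv 𝓘(ℝ, E) 𝓘(ℝ, E') F 1 (X i) = Y i)
    (h : IsHorizontalCurve X a b γ u) : IsHorizontalCurve Y a b (fun t => f (γ t)) u := by
  refine of_ae_hasMFDerivAt ⟨hf.continuous.comp_continuousOn h.1.1,
    fun φ hφ => h.1.2 (φ ∘ f) (hφ.comp hf)⟩ h.2.1 ?_
  filter_upwards [h.ae_hasMFDerivAt] with t ht
  refine ht.comp_of_semiconj hf hF hF1 hfF ?_
  obtain ⟨D, hD⟩ : ∃ D : E →L[ℝ] E', D = mfderiv 𝓘(ℝ, E) 𝓘(ℝ, E') F 1 := ⟨_, rfl⟩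
  have hDX : ∀ i, D (X i : E) = (Y i : E') := fun i => by rw [hD]; exact hFX i
  have key : D (horizontalVector X (u t)) = horizontalVector Y (u t) := by
    simp only [horizontalVector, sum_apply, map_sum]
    exact Finset.sum_congr rfl fun i _ => (D.map_smul (u t i) (X i)).trans
      (congrArg (fun z : E' => u t i • z) (hDX i))
  rw [hD] at key
  exact key

theorem mul_left (g : G) (h : IsHorizontalCurve X a b γ u) :
    IsHorizontalCurve X a b (fun t => g * γ t) u :=
  h.comp_of_semiconj (f := (g * ·)) (F := id) contMDiff_mul_left contMDiff_id rfl
    (fun x y => (mul_assoc g x y).symm) (fun i => by rw [mfderiv_id]; rfl)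

variable {V : Type*} [NormedAddCommGroup V] [NormedSpace ℝ V] {φ : G → V}

theorem integrableOn_frameDeriv (h : IsHorizontalCurve X a b γ u)
    (hφ : ContMDiff 𝓘(ℝ, E) 𝓘(ℝ, V) ∞ φ) :
    IntegrableOn (fun t => frameDeriv E φ (γ t) (horizontalVector X (u t))) (Icc a b) :=
  ((continuous_frameDeriv hφ).comp_continuousOn h.1.1).integrableOn_clm_apply
    ((horizontalVector X).integrable_comp h.2.1)

/-- The fundamental theorem of calculus along a horizontal curve. -/
theorem sub_eq_integral [CompleteSpace V] (h : IsHorizontalCurve X a b γ u)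
    (hφ : ContMDiff 𝓘(ℝ, E) 𝓘(ℝ, V) ∞ φ) {s t : ℝ} (has : a ≤ s) (hst : s ≤ t) (htb : t ≤ b) :
    φ (γ t) - φ (γ s) = ∫ τ in s..t, frameDeriv E φ (γ τ) (horizontalVector X (u τ)) := by
  have h' := h.mono hst has htb
  have hint : IntervalIntegrable (fun τ => frameDeriv E φ (γ τ) (horizontalVector X (u τ)))
      volume s t :=
    (intervalIntegrable_iff_integrableOn_Icc_of_le hst).2 (h'.integrableOn_frameDeriv hφ)
  -- Absolute continuity of the curve is tested by real functions only, so the identity is checked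
  -- against each dual functional.
  refine (SeparatingDual.eq_iff_forall_dual_eq (R := ℝ)).2 fun m => ?_
  rw [← ContinuousLinearMap.intervalIntegral_comp_comm m hint, map_sub]
  have h1 := h'.1.2 (fun x => m (φ x)) (m.contMDiff.comp hφ)
  have h2 := h1.integral_deriv_eq_sub
  rw [show m (φ (γ t)) - m (φ (γ s)) = _ from h2.symm]
  refine intervalIntegral.integral_congr_ae ?_
  have h3 := (ae_restrict_iff' measurableSet_Icc).1 h'.ae_hasMFDerivAt
  filter_upwards [h3] with τ hτ hmem
  rw [uIoc_of_le hst] at hmem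
  exact (m.hasFDerivAt.comp_hasDerivAt τ
    ((hτ (Ioc_subset_Icc_self hmem)).hasDerivAt_comp_of_mulInvariant hφ.contMDiffAt)).deriv

end IsHorizontalCurve

/-! ### The Carnot-Carathéodory distance -/

section CCDist

variable {E : Type*} [NormedAddCommGroup E] [NormedSpace ℝ E]
  {G : Type*} [TopologicalSpace G] [ChartedSpace E G] [Group G] {r : ℕ}
  {X : Fin r → GroupLieAlgebra 𝓘(ℝ, E) G} {a b : ℝ} {γ : ℝ → G} {u : ℝ → EuclideanSpace ℝ (Fin r)}

theorem IsHorizontalCurve.ccDist_le (h : IsHorizontalCurve X a b γ u) (hab : a ≤ b) :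
    ccDist X (γ a) (γ b) ≤ ∫⁻ t in Icc a b, ‖u t‖ₑ :=
  iInf_le_of_le a <| iInf_le_of_le b <| iInf_le_of_le γ <| iInf_le_of_le u <|
    iInf_le_of_le ⟨hab, h, rfl, rfl⟩ le_rfl

theorem le_ccDist_iff {x y : G} {C : ENNReal} : C ≤ ccDist X x y ↔ ∀ a b γ u, a ≤ b →
    IsHorizontalCurve X a b γ u → γ a = x → γ b = y → C ≤ ∫⁻ t in Icc a b, ‖u t‖ₑ := by
  simp only [ccDist, le_iInf_iff]
  exact ⟨fun h a b γ u h1 h2 h3 h4 => h a b γ u ⟨h1, h2, h3, h4⟩,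
    fun h a b γ u h1 => h a b γ u h1.1 h1.2.1 h1.2.2.1 h1.2.2.2⟩

variable [LieGroup 𝓘(ℝ, E) ∞ G]

theorem ccDist_map_le {E' : Type*} [NormedAddCommGroup E'] [NormedSpace ℝ E']
    {H : Type*} [TopologicalSpace H] [ChartedSpace E' H] [Group H] [LieGroup 𝓘(ℝ, E') ∞ H]
    {Y : Fin r → GroupLieAlgebra 𝓘(ℝ, E') H} {F : G →* H}
    (hF : ContMDiff 𝓘(ℝ, E) 𝓘(ℝ, E') ∞ F)
    (hFX : ∀ i, mfderiv 𝓘(ℝ, E) 𝓘(ℝ, E') F 1 (X i) = Y i) (x y : G) :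
    ccDist Y (F x) (F y) ≤ ccDist X x y := by
  refine le_ccDist_iff.2 fun a b γ u hab h hx hy => ?_
  subst hx hy
  exact (h.comp_of_semiconj hF hF (map_one F) (map_mul F) hFX).ccDist_le hab

/-- A smooth homomorphism to `ℝ` is Lipschitz for the Carnot-Carathéodory distance. -/
theorem isCCLipschitz_of_additive {p : G → ℝ} (hp : ∀ x y, p (x * y) = p x + p y)
    (hs : ContMDiff 𝓘(ℝ, E) 𝓘(ℝ, ℝ) ∞ p) : IsCCLipschitz X p := by
  -- The summand `1` makes `C` nonzero: dividing by `C` reduces the claim to a lower bound for the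
  -- length of each curve.
  set C : ℝ≥0 := 1 + ‖(frameDeriv E p 1).comp (horizontalVector X)‖₊ with hC
  refine ⟨C, fun x y => ?_⟩
  have hC0 : (C : ENNReal) ≠ 0 := by rw [hC]; positivity
  rw [mul_comm, ← ENNReal.div_le_iff hC0 ENNReal.coe_ne_top]
  refine le_ccDist_iff.2 fun a b γ u hab h hx hy => ?_
  subst hx hy
  rw [ENNReal.div_le_iff hC0 ENNReal.coe_ne_top, mul_comm, edist_comm, edist_eq_enorm_sub,
    h.sub_eq_integral hs le_rfl hab le_rfl, intervalIntegral.integral_of_le hab,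
    ← integral_Icc_eq_integral_Ioc]
  refine (enorm_integral_le_lintegral_enorm _).trans ?_
  rw [← lintegral_const_mul' _ _ ENNReal.coe_ne_top]
  refine lintegral_mono fun t => ?_
  rw [frameDeriv_eq_frameDeriv_one hp]
  refine (ContinuousLinearMap.le_opENorm ((frameDeriv E p 1).comp (horizontalVector X)) (u t)).trans ?_
  gcongr
  rw [enorm_eq_nnnorm]
  exact_mod_cast le_add_self

end CCDist

/-! ### Uniqueness of horizontal curves with given controls -/

section Uniqueness

variable {E : Type*} [NormedAddCommGroup E] [NormedSpace ℝ E] [FiniteDimensional ℝ E]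
  {G : Type*} [TopologicalSpace G] [ChartedSpace E G] [Group G] [LieGroup 𝓘(ℝ, E) ∞ G]
  [T2Space G] {r : ℕ} {X : Fin r → GroupLieAlgebra 𝓘(ℝ, E) G} {a b : ℝ} {γ₁ γ₂ : ℝ → G}
  {u : ℝ → EuclideanSpace ℝ (Fin r)}

/-- In a chart both curves solve an equation with `K`-Lipschitz coefficients. Where `K ∫ ‖u‖ < 1 /
2`, the maximal distance `M` between them satisfies `M ≤ M / 2`, so `M = 0`. -/
theorem IsHorizontalCurve.exists_eqOn_of_eq_left (h₁ : IsHorizontalCurve X a b γ₁ u)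
    (h₂ : IsHorizontalCurve X a b γ₂ u) (hab : a < b) (h0 : γ₁ a = γ₂ a) :
    ∃ c ∈ Ioc a b, EqOn γ₁ γ₂ (Icc a c) := by
  set g := γ₁ a with hg
  have : CompleteSpace E := FiniteDimensional.complete ℝ E
  set χ := extChartAt 𝓘(ℝ, E) g with hχ
  obtain ⟨f⟩ : Nonempty (SmoothBumpFunction 𝓘(ℝ, E) g) := inferInstance
  -- The chart is cut off to a global function, because the curves may only be tested by globally
  -- smooth functions.
  set ψ : G → E := fun x => f x • χ x with hψ
  have hψs : ContMDiff 𝓘(ℝ, E) 𝓘(ℝ, E) ∞ ψ :=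
    f.contMDiff_smul (contMDiffOn_extChartAt (x := g))
  set A : E → EuclideanSpace ℝ (Fin r) →L[ℝ] E :=
    fun x => (frameDeriv E ψ (χ.symm x)).comp (horizontalVector X) with hA
  have hAs : ContDiffAt ℝ 1 A (χ g) :=
    ((contDiffAt_frameDeriv (mem_extChartAt_target (I := 𝓘(ℝ, E)) g) hψs.contMDiffAt).of_le
      (by norm_cast)).clm_comp contDiffAt_const
  obtain ⟨K, s, hs, hK⟩ := hAs.exists_lipschitzOnWith
  have hN : ∀ᶠ x in nhds g, x ∈ χ.source ∧ f x = 1 ∧ χ x ∈ s :=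
    Filter.Eventually.and (extChartAt_source_mem_nhds (I := 𝓘(ℝ, E)) g)
      (f.eventuallyEq_one.and ((continuousAt_extChartAt (I := 𝓘(ℝ, E)) g).eventually hs))
  have hnhds : nhdsWithin a (Icc a b) = nhdsWithin a (Ici a) := nhdsWithin_Icc_eq_nhdsGE hab
  have haI : a ∈ Icc a b := left_mem_Icc.2 hab.le
  have e1 : ∀ᶠ t in nhdsWithin a (Ici a), γ₁ t ∈ χ.source ∧ f (γ₁ t) = 1 ∧ χ (γ₁ t) ∈ s := by
    rw [← hnhds]
    exact (h₁.1.1 a haI).eventually hN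
  have e2 : ∀ᶠ t in nhdsWithin a (Ici a), γ₂ t ∈ χ.source ∧ f (γ₂ t) = 1 ∧ χ (γ₂ t) ∈ s := by
    rw [← hnhds]
    have h := h₂.1.1 a haI
    rw [ContinuousWithinAt, ← h0] at h
    exact h.eventually hN
  have hu : IntervalIntegrable u volume a b :=
    (intervalIntegrable_iff_integrableOn_Icc_of_le hab.le).2 h₁.2.1
  have e3 : ∀ᶠ t in nhdsWithin a (Ici a), K * ∫ τ in a..t, ‖u τ‖ < 1 / 2 := by
    rw [← hnhds]
    have h := (intervalIntegral.continuousOn_primitive_interval' hu.norm left_mem_uIcc) a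
      left_mem_uIcc
    rw [uIcc_of_le hab.le] at h
    refine (h.const_mul (K : ℝ)).eventually (gt_mem_nhds ?_)
    simp
  obtain ⟨c', hc', hsub⟩ := mem_nhdsGE_iff_exists_Icc_subset.1 (e1.and (e2.and e3))
  set c := min c' b with hc
  have hac : a < c := lt_min hc' hab
  have hcb : c ≤ b := min_le_right _ _
  have hsub' : ∀ t ∈ Icc a c, _ := fun t ht => hsub ⟨ht.1, ht.2.trans (min_le_left _ _)⟩
  refine ⟨c, ⟨hac, hcb⟩, ?_⟩
  have hcont : ContinuousOn (fun t => ‖ψ (γ₁ t) - ψ (γ₂ t)‖) (Icc a c) :=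
    ((hψs.continuous.comp_continuousOn (h₁.1.1.mono (Icc_subset_Icc_right hcb))).sub
      (hψs.continuous.comp_continuousOn (h₂.1.1.mono (Icc_subset_Icc_right hcb)))).norm
  obtain ⟨m, hm, hmax⟩ := isCompact_Icc.exists_isMaxOn ⟨a, left_mem_Icc.2 hac.le⟩ hcont
  set M := ‖ψ (γ₁ m) - ψ (γ₂ m)‖ with hM
  have hψχ : ∀ t ∈ Icc a c, ψ (γ₁ t) = χ (γ₁ t) ∧ ψ (γ₂ t) = χ (γ₂ t) := by
    intro t ht
    obtain ⟨k1, k2, -⟩ := hsub' t ht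
    simp only [hψ, k1.2.1, k2.2.1, one_smul, and_self]
  have hM0 : M ≤ 1 / 2 * M := by
    have i1 := h₁.sub_eq_integral hψs le_rfl hm.1 (hm.2.trans hcb)
    have i2 := h₂.sub_eq_integral hψs le_rfl hm.1 (hm.2.trans hcb)
    have j1 := (intervalIntegrable_iff_integrableOn_Icc_of_le hm.1).2
      ((h₁.mono hm.1 le_rfl (hm.2.trans hcb)).integrableOn_frameDeriv hψs)
    have j2 := (intervalIntegrable_iff_integrableOn_Icc_of_le hm.1).2
      ((h₂.mono hm.1 le_rfl (hm.2.trans hcb)).integrableOn_frameDeriv hψs)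
    have i3 : ψ (γ₁ m) - ψ (γ₂ m) = ∫ τ in a..m, (frameDeriv E ψ (γ₁ τ) (horizontalVector X (u τ)) -
        frameDeriv E ψ (γ₂ τ) (horizontalVector X (u τ))) := by
      rw [intervalIntegral.integral_sub j1 j2, ← i1, ← i2, ← hg, ← h0]
      abel
    have j3 : IntervalIntegrable (fun τ => K * M * ‖u τ‖) volume a m :=
      (hu.mono_set (by
        rw [uIcc_of_le hm.1, uIcc_of_le hab.le]
        exact Icc_subset_Icc_right (hm.2.trans hcb))).norm.const_mul _
    calc M = ‖∫ τ in a..m, (frameDeriv E ψ (γ₁ τ) (horizontalVector X (u τ)) -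
        frameDeriv E ψ (γ₂ τ) (horizontalVector X (u τ)))‖ := by rw [hM, i3]
      _ ≤ ∫ τ in a..m, K * M * ‖u τ‖ := by
        refine intervalIntegral.norm_integral_le_of_norm_le hm.1 ?_ j3
        refine Filter.Eventually.of_forall fun τ hτ => ?_
        have hτ' : τ ∈ Icc a c := ⟨hτ.1.le, hτ.2.trans hm.2⟩
        obtain ⟨k1, k2, -⟩ := hsub' τ hτ'
        have l1 : ∀ z ∈ χ.source, frameDeriv E ψ z (horizontalVector X (u τ)) = A (χ z) (u τ) := by
          intro z hz
          simp only [hA, ContinuousLinearMap.comp_apply, χ.left_inv hz]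
        rw [l1 _ k1.1, l1 _ k2.1, ← sub_apply]
        refine (ContinuousLinearMap.le_opNorm _ _).trans ?_
        gcongr
        refine (hK.norm_sub_le k1.2.2 k2.2.2).trans ?_
        gcongr
        rw [← (hψχ τ hτ').1, ← (hψχ τ hτ').2]
        exact hmax hτ'
      _ = (K * ∫ τ in a..m, ‖u τ‖) * M := by rw [intervalIntegral.integral_const_mul]; ring
      _ ≤ 1 / 2 * M := by
        gcongr
        exact (hsub' m hm).2.2.le
  have hM1 : M ≤ 0 := by linarith
  intro t ht
  have h3 : ‖ψ (γ₁ t) - ψ (γ₂ t)‖ ≤ 0 := (hmax ht).trans hM1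
  have h4 := sub_eq_zero.1 (norm_le_zero_iff.1 h3)
  rw [(hψχ t ht).1, (hψχ t ht).2] at h4
  exact χ.injOn (hsub' t ht).1.1 (hsub' t ht).2.1.1 h4

/-- A horizontal curve is determined by its controls and its starting point. -/
theorem IsHorizontalCurve.eqOn_of_eq_left (h₁ : IsHorizontalCurve X a b γ₁ u)
    (h₂ : IsHorizontalCurve X a b γ₂ u) (h0 : γ₁ a = γ₂ a) : EqOn γ₁ γ₂ (Icc a b) := by
  -- Continuity method: the agreement set is closed as `G` is Hausdorff, and local uniqueness
  -- extends it to the right.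
  refine IsClosed.Icc_subset_of_forall_exists_gt (s := {t | γ₁ t = γ₂ t}) ?_ h0 ?_
  · rw [inter_comm]
    exact (h₁.1.1.prodMk h₂.1.1).preimage_isClosed_of_isClosed isClosed_Icc isClosed_diagonal
  · rintro x ⟨hx, hxI⟩ y hy
    have hxb : x < min y b := lt_min hy hxI.2
    obtain ⟨c, hc, hcs⟩ := (h₁.mono hxb.le hxI.1 (min_le_right _ _)).exists_eqOn_of_eq_left
      (h₂.mono hxb.le hxI.1 (min_le_right _ _)) hxb hx
    exact ⟨c, hcs (right_mem_Icc.2 hc.1.le), hc.1, hc.2.trans (min_le_left _ _)⟩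

end Uniqueness

/-! ### Existence of horizontal curves with small controls -/

theorem AbsolutelyContinuousOnInterval.of_dist_le {X Y : Type*} [PseudoMetricSpace X]
    [PseudoMetricSpace Y] {f : ℝ → X} {w : ℝ → Y} {a b : ℝ}
    (hw : AbsolutelyContinuousOnInterval w a b) (h : ∀ s t, dist (f s) (f t) ≤ dist (w s) (w t)) :
    AbsolutelyContinuousOnInterval f a b :=
  squeeze_zero (fun _ => Finset.sum_nonneg fun _ _ => dist_nonneg)
    (fun _ => Finset.sum_le_sum fun _ _ => h _ _) hw

section IntegralEquation

variable {V W : Type*} [NormedAddCommGroup V] [NormedSpace ℝ V] [NormedAddCommGroup W]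
  [NormedSpace ℝ W]

theorem MeasureTheory.Integrable.clm_apply_of_continuous {B : ℝ → V →L[ℝ] W} {u : ℝ → V} {C : ℝ}
    (hB : Continuous B) (hC : ∀ t, ‖B t‖ ≤ C) (hu : Integrable u) :
    Integrable (fun t => B t (u t)) := by
  refine Integrable.mono' (hu.norm.const_mul C) ?_ ?_
  · exact (ContinuousLinearMap.id ℝ (V →L[ℝ] W)).aestronglyMeasurable_comp₂
      hB.aestronglyMeasurable hu.aestronglyMeasurable
  · exact Filter.Eventually.of_forall fun t => (B t).le_of_opNorm_le (hC t) (u t)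

theorem MeasureTheory.Integrable.norm_intervalIntegral_le {f : ℝ → W} {g : ℝ → ℝ}
    (hg : Integrable g) (h : ∀ t, ‖f t‖ ≤ g t) (a t : ℝ) :
    ‖∫ s in a..t, f s‖ ≤ ∫ s, g s := by
  have hg0 : ∀ t, 0 ≤ g t := fun t => (norm_nonneg _).trans (h t)
  refine (intervalIntegral.norm_integral_le_integral_norm_uIoc).trans ?_
  calc ∫ s in uIoc a t, ‖f s‖ ≤ ∫ s in uIoc a t, g s :=
        integral_mono_of_nonneg (Filter.Eventually.of_forall fun _ => norm_nonneg _)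
          hg.integrableOn (Filter.Eventually.of_forall h)
    _ ≤ ∫ s, g s := setIntegral_le_integral hg (Filter.Eventually.of_forall hg0)

/-- The controlled integral equation `x(t) = x₀ + ∫ B(x) u` with bounded Lipschitz `B` is solvable
for controls of small total mass. -/
theorem exists_eq_add_integral [CompleteSpace W] {B : W → V →L[ℝ] W} {C : ℝ} {K : ℝ≥0}
    (hB : LipschitzWith K B) (hC : ∀ x, ‖B x‖ ≤ C) {u : ℝ → V} (hu : Integrable u)
    (hK : K * ∫ t, ‖u t‖ < 1) (a : ℝ) (x₀ : W) :
    ∃ x : ℝ → W, Continuous x ∧ ∀ t, x t = x₀ + ∫ s in a..t, B (x s) (u s) := by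
  have hint : ∀ x : BoundedContinuousFunction ℝ W, Integrable fun s => B (x s) (u s) := fun x =>
    hu.clm_apply_of_continuous (hB.continuous.comp x.continuous) (fun t => hC (x t))
  have hbd : ∀ (x : BoundedContinuousFunction ℝ W) (t : ℝ),
      ‖x₀ + ∫ s in a..t, B (x s) (u s)‖ ≤ ‖x₀‖ + ∫ s, C * ‖u s‖ := fun x t =>
    (norm_add_le _ _).trans (add_le_add_right ((hu.norm.const_mul C).norm_intervalIntegral_le
      (fun s => (B (x s)).le_of_opNorm_le (hC _) (u s)) a t) _)
  -- Picard operator on the whole line. It preserves boundedness because `B` is bounded and `u`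
  -- integrable, and it contracts by the factor `K ∫ ‖u‖`.
  set Φ : BoundedContinuousFunction ℝ W → BoundedContinuousFunction ℝ W := fun x =>
    BoundedContinuousFunction.ofNormedAddCommGroup (fun t => x₀ + ∫ s in a..t, B (x s) (u s))
      (continuous_const.add ((hint x).continuous_primitive a)) _ (hbd x) with hΦ
  obtain ⟨κ, hκ⟩ : ∃ κ : ℝ≥0, (κ : ℝ) = K * ∫ t, ‖u t‖ := ⟨⟨_, by positivity⟩, rfl⟩
  have hΦc : ContractingWith κ Φ := by
    refine ⟨by rw [← NNReal.coe_lt_coe, hκ]; exact hK, LipschitzWith.of_dist_le_mul fun x y => ?_⟩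
    refine (BoundedContinuousFunction.dist_le (by positivity)).2 fun t => ?_
    have e : Φ x t - Φ y t = ∫ s in a..t, (B (x s) (u s) - B (y s) (u s)) := by
      rw [intervalIntegral.integral_sub (hint x).intervalIntegrable (hint y).intervalIntegrable]
      exact add_sub_add_left_eq_sub _ _ _
    rw [dist_eq_norm, e]
    refine ((hu.norm.const_mul (K * dist x y)).norm_intervalIntegral_le (fun s => ?_) a t).trans ?_
    · rw [← sub_apply]
      refine (B (x s) - B (y s)).le_of_opNorm_le ?_ (u s)
      rw [← dist_eq_norm]
      refine (hB.dist_le_mul _ _).trans ?_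
      gcongr
      exact BoundedContinuousFunction.dist_coe_le_dist s
    · rw [integral_const_mul]
      refine le_of_eq ?_
      rw [hκ]
      ring
  obtain ⟨x, hx⟩ : ∃ x, Φ x = x := ⟨_, hΦc.fixedPoint_isFixedPt⟩
  exact ⟨x, x.continuous, fun t => congrArg (fun y : BoundedContinuousFunction ℝ W => y t) hx.symm⟩

end IntegralEquation

section Existence

variable {E : Type*} [NormedAddCommGroup E] [NormedSpace ℝ E] [FiniteDimensional ℝ E]
  {G : Type*} [TopologicalSpace G] [ChartedSpace E G] [Group G] [LieGroup 𝓘(ℝ, E) ∞ G] {r : ℕ}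

/-- Controls of small total mass are the controls of a horizontal curve with prescribed starting
point. -/
theorem exists_isHorizontalCurve (X : Fin r → GroupLieAlgebra 𝓘(ℝ, E) G) :
    ∃ δ : ℝ, 0 < δ ∧ ∀ (a b : ℝ) (u : ℝ → EuclideanSpace ℝ (Fin r)) (g : G),
      IntegrableOn u (Icc a b) → ∫ t in Icc a b, ‖u t‖ < δ →
      ∃ γ : ℝ → G, IsHorizontalCurve X a b γ u ∧ γ a = g := by
  have : CompleteSpace E := FiniteDimensional.complete ℝ E
  set χ := extChartAt 𝓘(ℝ, E) (1 : G) with hχ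
  have hχo : IsOpen χ.target := isOpen_extChartAt_target (I := 𝓘(ℝ, E)) (1 : G)
  obtain ⟨R, hR, hRt⟩ := Metric.isOpen_iff.1 hχo _ (mem_extChartAt_target (I := 𝓘(ℝ, E)) (1 : G))
  -- The cut-off makes the coefficients globally bounded and Lipschitz without changing them on the
  -- ball of radius `R / 4`.
  set β : ContDiffBump (χ 1) := ⟨R / 4, R / 2, by positivity, by linarith⟩ with hβ
  set B : E → EuclideanSpace ℝ (Fin r) →L[ℝ] E :=
    fun x => β x • (frameDeriv E χ (χ.symm x)).comp (horizontalVector X) with hB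
  have hts : tsupport β ⊆ χ.target := by
    rw [β.tsupport_eq]
    exact (Metric.closedBall_subset_ball (by simp only [hβ]; linarith)).trans hRt
  have hBs : ContDiff ℝ ∞ B := by
    refine contDiff_iff_contDiffAt.2 fun x => ?_
    by_cases hx : x ∈ tsupport β
    · exact β.contDiffAt.smul ((contDiffAt_frameDeriv_extChartAt (hts hx)).clm_comp contDiffAt_const)
    · refine contDiffAt_const (c := 0) |>.congr_of_eventuallyEq ?_
      filter_upwards [(isClosed_tsupport β).isOpen_compl.mem_nhds hx] with y hy
      simp only [hB, image_eq_zero_of_notMem_tsupport hy, zero_smul]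
  have hBc : HasCompactSupport B := β.hasCompactSupport.smul_right
  obtain ⟨C₀, hC₀⟩ := hBs.continuous.bounded_above_of_compact_support hBc
  obtain ⟨K, hK⟩ := ContDiff.lipschitzWith_of_hasCompactSupport hBc hBs (by simp)
  set C := max C₀ 1 with hC
  have hC1 : 0 < C := lt_max_of_lt_right one_pos
  have hCB : ∀ x, ‖B x‖ ≤ C := fun x => (hC₀ x).trans (le_max_left _ _)
  -- The first bound makes the Picard operator a contraction; the second keeps the solution in the
  -- ball where the cut-off equals `1`. Neither depends on `g`, since the curve is built at `1` and
  -- translated.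
  refine ⟨min (1 / (K + 1)) (R / 4 / C), by positivity, fun a b u g hu hδ => ?_⟩
  set v : ℝ → EuclideanSpace ℝ (Fin r) := (Icc a b).indicator u with hv
  have hvi : Integrable v := hu.integrable_indicator measurableSet_Icc
  have hvn : ∫ t, ‖v t‖ = ∫ t in Icc a b, ‖u t‖ := by
    rw [← integral_indicator measurableSet_Icc]
    simp only [hv, norm_indicator_eq_indicator_norm]
  have hδ1 : K * ∫ t, ‖v t‖ < 1 := by
    rw [hvn]
    have h1 := hδ.trans_le (min_le_left _ _)
    rw [lt_div_iff₀ (by positivity)] at h1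
    have h2 : 0 ≤ ∫ t in Icc a b, ‖u t‖ := by positivity
    nlinarith
  obtain ⟨x, hxc, hx⟩ := exists_eq_add_integral hK hCB hvi hδ1 a (χ 1)
  have hxint : Integrable fun s => B (x s) (v s) :=
    hvi.clm_apply_of_continuous (hK.continuous.comp hxc) fun t => hCB (x t)
  have hxball : ∀ t, x t ∈ Metric.closedBall (χ 1) (R / 4) := by
    intro t
    rw [mem_closedBall_iff_norm, hx t, add_sub_cancel_left]
    refine ((hvi.norm.const_mul C).norm_intervalIntegral_le
      (fun s => (B (x s)).le_of_opNorm_le (hCB _) (v s)) a t).trans ?_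
    rw [integral_const_mul, hvn]
    have h1 := hδ.trans_le (min_le_right _ _)
    rw [lt_div_iff₀ hC1] at h1
    linarith
  have hsub : Metric.closedBall (χ 1) (R / 4) ⊆ χ.target :=
    (Metric.closedBall_subset_ball (by linarith)).trans hRt
  have hxt : ∀ t, x t ∈ χ.target := fun t => hsub (hxball t)
  have hγc : Continuous fun t => χ.symm (x t) :=
    (continuousOn_extChartAt_symm (I := 𝓘(ℝ, E)) (1 : G)).comp_continuous hxc hxt
  have hxa : χ.symm (x a) = 1 := by
    rw [hx a, intervalIntegral.integral_same, add_zero]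
    exact extChartAt_to_inv (1 : G)
  suffices h : IsHorizontalCurve X a b (fun t => χ.symm (x t)) u from
    ⟨_, h.mul_left g, by rw [hxa, mul_one]⟩
  refine IsHorizontalCurve.of_ae_hasMFDerivAt ⟨hγc.continuousOn, fun φ hφ => ?_⟩ hu ?_
  · have h1 : ContDiffOn ℝ 1 (fun y => φ (χ.symm y)) (Metric.closedBall (χ 1) (R / 4)) := by
      intro y hy
      have := hφ.contMDiffAt.comp y (contMDiffAt_symm_extChartAt_of_mem (hsub hy))
      exact (this.contDiffAt.of_le (by norm_cast)).contDiffWithinAt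
    obtain ⟨L, hL⟩ := h1.exists_lipschitzOnWith (by simp) (convex_closedBall _ _)
      (isCompact_closedBall _ _)
    -- Increments of `φ` along the curve are dominated by those of `L ∫ C ‖v‖`, which is absolutely
    -- continuous.
    have hw := (hvi.norm.const_mul C).intervalIntegrable (a := a) (b := b)
      |>.absolutelyContinuousOnInterval_intervalIntegral (c := a) left_mem_uIcc |>.const_mul (L : ℝ)
    refine hw.of_dist_le fun s t => ?_
    refine (hL.dist_le_mul _ (hxball s) _ (hxball t)).trans ?_
    rw [Real.dist_eq, ← mul_sub, abs_mul, NNReal.abs_eq]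
    gcongr
    have hi := (hvi.norm.const_mul C)
    rw [dist_eq_norm, hx s, hx t, add_sub_add_left_eq_sub,
      intervalIntegral.integral_interval_sub_left hxint.intervalIntegrable
        hxint.intervalIntegrable,
      intervalIntegral.integral_interval_sub_left hi.intervalIntegrable hi.intervalIntegrable]
    refine intervalIntegral.norm_integral_le_abs_of_norm_le ?_ hi.intervalIntegrable
    exact Filter.Eventually.of_forall fun τ => (B (x τ)).le_of_opNorm_le (hCB _) (v τ)
  · rw [ae_restrict_iff' measurableSet_Icc]
    filter_upwards [LocallyIntegrable.ae_hasDerivAt_integral hxint.locallyIntegrable] with t ht htI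
    have h1 : HasDerivAt x (B (x t) (v t)) t := by
      have := (ht a).const_add (χ 1)
      exact this.congr_of_eventuallyEq (Filter.Eventually.of_forall hx)
    have h2 : B (x t) (v t) = frameDeriv E χ (χ.symm (x t)) (horizontalVector X (u t)) := by
      simp only [hB, hv, indicator_of_mem htI]
      rw [β.one_of_mem_closedBall (hxball t), one_smul]
      rfl
    refine hasMFDerivAt_of_hasDerivAt_extChartAt (x₀ := (1 : G)) (χ.map_target (hxt t))
      hγc.continuousAt ?_
    rw [← h2]
    refine h1.congr_of_eventuallyEq (Filter.Eventually.of_forall fun s => ?_)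
    exact χ.right_inv (hxt s)

end Existence

/-! ### Lifting short horizontal curves -/

section Lift

variable {E : Type*} [NormedAddCommGroup E] [NormedSpace ℝ E] [FiniteDimensional ℝ E]
  {G : Type*} [TopologicalSpace G] [ChartedSpace E G] [Group G] [LieGroup 𝓘(ℝ, E) ∞ G]
  {E' : Type*} [NormedAddCommGroup E'] [NormedSpace ℝ E'] [FiniteDimensional ℝ E']
  {H : Type*} [TopologicalSpace H] [T2Space H] [ChartedSpace E' H] [Group H]
  [LieGroup 𝓘(ℝ, E') ∞ H] {r : ℕ}

/-- Short horizontal curves lift through a homomorphism that maps the frames to each other. -/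
theorem exists_lift_of_isHorizontalCurve {X : Fin r → GroupLieAlgebra 𝓘(ℝ, E) G}
    {Y : Fin r → GroupLieAlgebra 𝓘(ℝ, E') H} {F : G →* H}
    (hF : ContMDiff 𝓘(ℝ, E) 𝓘(ℝ, E') ∞ F)
    (hFX : ∀ i, mfderiv 𝓘(ℝ, E) 𝓘(ℝ, E') F 1 (X i) = Y i) :
    ∃ δ : ℝ≥0, 0 < δ ∧ ∀ (a b : ℝ) (η : ℝ → H) (u : ℝ → EuclideanSpace ℝ (Fin r)) (x : G), a ≤ b →
      IsHorizontalCurve Y a b η u → η a = F x → ∫⁻ t in Icc a b, ‖u t‖ₑ < δ →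
      ∃ y, F y = η b ∧ ccDist X x y ≤ ∫⁻ t in Icc a b, ‖u t‖ₑ := by
  obtain ⟨δ, hδ, h⟩ := exists_isHorizontalCurve X
  refine ⟨⟨δ, hδ.le⟩, hδ, fun a b η u x hab hη hηa hu => ?_⟩
  obtain ⟨γ, hγ, rfl⟩ := h a b u x hη.2.1 (by
    rw [integral_norm_eq_lintegral_enorm hη.2.1.aestronglyMeasurable]
    exact ENNReal.toReal_lt_of_lt_ofReal (by
      rwa [ENNReal.ofReal_eq_coe_nnreal hδ.le]))
  -- `F ∘ γ` and `η` have the same controls and starting point, so they also end at the same point.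
  exact ⟨γ b, (hγ.comp_of_semiconj hF hF (map_one F) (map_mul F) hFX).eqOn_of_eq_left hη hηa.symm
    (right_mem_Icc.2 hab), hγ.ccDist_le hab⟩

end Lift

/-! ### Images of universal differentiability sets -/

section Image

variable {E : Type*} [NormedAddCommGroup E] [NormedSpace ℝ E] [FiniteDimensional ℝ E]
  {G : Type*} [TopologicalSpace G] [T2Space G] [ChartedSpace E G] [Group G]
  [LieGroup 𝓘(ℝ, E) ∞ G] [SimplyConnectedSpace G]

/-- Every functional on the horizontal layer comes from a smooth `G`-linear function. -/
theorem Stratification.exists_isGLinear (S : Stratification E G) (m : S.horizontal →ₗ[ℝ] ℝ) :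
    ∃ p : G → ℝ, ContMDiff 𝓘(ℝ, E) 𝓘(ℝ, ℝ) ∞ p ∧ IsGLinear S p ∧
      ∀ v : S.horizontal, p (lieExp (v : GroupLieAlgebra 𝓘(ℝ, E) G)) = m v := by
  have : CompleteSpace E := FiniteDimensional.complete ℝ E
  obtain ⟨l, hl, hl2⟩ := S.exists_linearMap_horizontal m
  obtain ⟨p, hps, hp, hpl⟩ := exists_additive_of_vanish_bracket (E := E) (G := G)
    (l := LinearMap.toContinuousLinearMap (E := E) (F' := ℝ) l)
    (fun v w => Stratification.map_bracket hl2 v w)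
  have hexp : ∀ v, p (lieExp v) = l v := by
    intro v
    rw [additive_lieExp hp hps v, hpl]
    rfl
  refine ⟨p, hps, ⟨hp, fun c _ v => ?_⟩, fun v => by rw [hexp, hl]⟩
  rw [hexp, hexp, Stratification.map_algDilation hl2]

/-- The homomorphism `p - L` vanishes on the one-parameter groups of a spanning set: on the
horizontal basis by hypothesis and homogeneity, on the other layers because `p` and `L` vanish there
separately. -/
theorem IsGLinear.eq_of_lieExp {S : Stratification E G} {L p : G → ℝ} (hL : IsGLinear S L)
    (hp : ∀ x y, p (x * y) = p x + p y) (hps : ContMDiff 𝓘(ℝ, E) 𝓘(ℝ, ℝ) ∞ p) {r : ℕ}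
    (X : Module.Basis (Fin r) ℝ S.horizontal)
    (h : ∀ j, p (lieExp (X j : GroupLieAlgebra 𝓘(ℝ, E) G)) =
      L (lieExp (X j : GroupLieAlgebra 𝓘(ℝ, E) G))) (g : G) : p g = L g := by
  have : CompleteSpace E := FiniteDimensional.complete ℝ E
  refine sub_eq_zero.1 (additive_eq_zero_of_lieExp (M := fun g => p g - L g)
    (fun x y => by rw [hp, hL.1]; ring)
    (s := {v | (∃ i, 2 ≤ i ∧ i ≤ S.step ∧ v ∈ S.layer i) ∨
      ∃ j, v = (X j : GroupLieAlgebra 𝓘(ℝ, E) G)}) ?_ ?_ g)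
  · refine eq_top_iff.2 fun v _ => ?_
    refine S.induction_on_layers (P := fun v => v ∈ Submodule.span ℝ _) ?_ (Submodule.zero_mem _)
      (fun v w hv hw => Submodule.add_mem _ hv hw) v
    intro i h1 hi v hv
    rcases h1.eq_or_lt with rfl | h2
    · have h3 := congrArg (Subtype.val) (X.sum_repr ⟨v, hv⟩)
      rw [Submodule.coe_sum] at h3
      change _ = v at h3
      rw [← h3]
      exact Submodule.sum_mem _ fun j _ => Submodule.smul_mem _ _
        (Submodule.subset_span (Or.inr ⟨j, rfl⟩))
    · exact Submodule.subset_span (Or.inl ⟨i, h2, hi, hv⟩)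
  · rintro v (⟨i, h2, hi, hv⟩ | ⟨j, rfl⟩) t
    · rw [hL.lieExp_eq_zero h2 hi (Submodule.smul_mem _ t hv), additive_lieExp hp hps,
        Stratification.frameDeriv_one_eq_zero_of_mem_layer S hp hps h2 hi
          (Submodule.smul_mem _ t hv), sub_zero]
    · rw [hL.lieExp_smul (X j).2, ← h j, additive_lieExp hp hps, additive_lieExp hp hps]
      exact sub_eq_zero.2 ((frameDeriv E p 1).map_smul t _)

variable {E' : Type*} [NormedAddCommGroup E'] [NormedSpace ℝ E'] [FiniteDimensional ℝ E']
  {H : Type*} [TopologicalSpace H] [T2Space H] [ChartedSpace E' H] [Group H]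
  [LieGroup 𝓘(ℝ, E') ∞ H] {r : ℕ}

theorem IsUDS.image [SimplyConnectedSpace H] {S : Stratification E G} {T : Stratification E' H}
    (X : Module.Basis (Fin r) ℝ S.horizontal) (Y : Module.Basis (Fin r) ℝ T.horizontal)
    {F : G →* H} (hF : ContMDiff 𝓘(ℝ, E) 𝓘(ℝ, E') ∞ F)
    (hFX : ∀ i, mfderiv 𝓘(ℝ, E) 𝓘(ℝ, E') F 1 (X i : GroupLieAlgebra 𝓘(ℝ, E) G) =
      (Y i : GroupLieAlgebra 𝓘(ℝ, E') H))
    {N : Set G} (hN : IsUDS S (fun i => (X i : GroupLieAlgebra 𝓘(ℝ, E) G)) N) :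
    IsUDS T (fun i => (Y i : GroupLieAlgebra 𝓘(ℝ, E') H)) (F '' N) := by
  have : CompleteSpace E := FiniteDimensional.complete ℝ E
  have : CompleteSpace E' := FiniteDimensional.complete ℝ E'
  rintro f ⟨K, hK⟩
  obtain ⟨x, hx, L, hL, hdiff⟩ := hN (fun g => f (F g)) ⟨K, fun g h =>
    (hK _ _).trans (mul_le_mul_right (ccDist_map_le hF hFX g h) _)⟩
  refine ⟨F x, mem_image_of_mem F hx, ?_⟩
  -- The differential on `H` is forced: it must take the value `L (exp X_i)` at `exp Y_i`, since `F
  -- (exp X_i) = exp Y_i`.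
  obtain ⟨p, hps, hpL, hpY⟩ := T.exists_isGLinear (Y.constr ℝ fun i =>
    L (lieExp (X i : GroupLieAlgebra 𝓘(ℝ, E) G)))
  have hpF : ∀ g, p (F g) = L g := by
    refine hL.eq_of_lieExp (p := fun g => p (F g)) (fun g h => by rw [map_mul, hpL.1])
      (hps.comp hF) X fun j => ?_
    rw [map_lieExp hF (hFX j), hpY, Module.Basis.constr_basis]
  refine ⟨p, hpL, fun ε hε => ?_⟩
  obtain ⟨δ₁, hδ₁, h₁⟩ := hdiff ε hε
  obtain ⟨δ₂, hδ₂, h₂⟩ := exists_lift_of_isHorizontalCurve hF hFX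
  refine ⟨min δ₁ δ₂, lt_min hδ₁ hδ₂, fun z hz => ?_⟩
  have hε0 : (ε : ENNReal) ≠ 0 := by exact_mod_cast hε.ne'
  -- The bound is proved against the length of each curve, as the infimum in `ccDist` need not be
  -- attained.
  have short : ∀ a b η u, a ≤ b →
      IsHorizontalCurve (fun i => (Y i : GroupLieAlgebra 𝓘(ℝ, E') H)) a b η u → η a = F x →
      η b = z → ∫⁻ t in Icc a b, ‖u t‖ₑ < (min δ₁ δ₂ : ℝ≥0) →
      ENNReal.ofReal |f z - f (F x) - p ((F x)⁻¹ * z)| / ε ≤ ∫⁻ t in Icc a b, ‖u t‖ₑ := by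
    intro a b η u hab hη ha hb hu
    obtain ⟨y, hy, hxy⟩ := h₂ a b η u x hab hη ha
      (hu.trans_le (by exact_mod_cast min_le_right _ _))
    rw [hb] at hy
    subst hy
    rw [ENNReal.div_le_iff hε0 ENNReal.coe_ne_top, mul_comm, ← map_inv, ← map_mul, hpF]
    refine (h₁ y ((hxy.trans_lt hu).trans_le (by exact_mod_cast min_le_left _ _))).trans ?_
    gcongr
  rw [mul_comm, ← ENNReal.div_le_iff hε0 ENNReal.coe_ne_top]
  refine le_ccDist_iff.2 fun a b η u hab hη ha hb => ?_
  have hz' := hz.not_ge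
  rw [le_ccDist_iff] at hz'
  push Not at hz'
  obtain ⟨a', b', η', u', hab', hη', ha', hb', hu'⟩ := hz'
  -- A curve too long to be lifted is longer than some short curve to `z`, for which the bound is
  -- known.
  rcases lt_or_ge (∫⁻ t in Icc a b, ‖u t‖ₑ) (min δ₁ δ₂ : ℝ≥0) with hu | hu
  · exact short a b η u hab hη ha hb hu
  · exact (short a' b' η' u' hab' hη' ha' hb' hu').trans (hu'.le.trans hu)

end Image

/-! ### Hausdorff measure and Lipschitz maps -/

section HausdorffMeasure

variable {M M' : Type*} {d : M → M → ENNReal} {d' : M' → M' → ENNReal}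

theorem distDiam_image_le {f : M → M'} (h : ∀ x y, d' (f x) (f y) ≤ d x y) (A : Set M) :
    distDiam d' (f '' A) ≤ distDiam d A := by
  simp only [distDiam, iSup_le_iff, forall_mem_image]
  exact fun x hx y hy => (h x y).trans
    (le_iSup₂_of_le x hx (le_iSup₂_of_le (f := fun y _ => d x y) y hy le_rfl))

theorem hausdorffMeasureOf_image_le {f : M → M'} (h : ∀ x y, d' (f x) (f y) ≤ d x y) {s : ℝ}
    (hs : 0 ≤ s) (A : Set M) : hausdorffMeasureOf d' s (f '' A) ≤ hausdorffMeasureOf d s A := by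
  refine iSup₂_mono fun ρ hρ => le_iInf fun U => le_iInf fun hAU => le_iInf fun hU => ?_
  refine iInf_le_of_le (fun n => f '' U n) (iInf_le_of_le ?_ (iInf_le_of_le
    (fun n => (distDiam_image_le h (U n)).trans (hU n)) ?_))
  · rw [← image_iUnion]
    exact image_mono hAU
  · refine ENNReal.tsum_le_tsum fun n => iSup_le fun hn => ?_
    exact le_iSup_of_le hn.of_image (ENNReal.rpow_le_rpow (distDiam_image_le h (U n)) hs)

theorem hausdorffDimOf_image_le {f : M → M'} (h : ∀ x y, d' (f x) (f y) ≤ d x y) (A : Set M) :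
    hausdorffDimOf d' (f '' A) ≤ hausdorffDimOf d A :=
  iSup₂_le fun s hs => le_iSup₂_of_le (f := fun (s : ℝ≥0) _ => (s : ENNReal)) s
    (top_le_iff.1 (hs.ge.trans (hausdorffMeasureOf_image_le h s.2 A))) le_rfl

theorem hausdorffDimOf_subsingleton (hd : ∀ x, d x x = 0) {A : Set M} (hA : A.Subsingleton) :
    hausdorffDimOf d A = 0 := by
  refine le_bot_iff.1 (iSup₂_le fun s hs => ?_)
  by_contra hne
  have hs0 : (0 : ℝ) < s := by
    rcases eq_or_lt_of_le (zero_le (a := s)) with h | h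
    · exact absurd (by rw [← h]; simp) hne
    · exact_mod_cast h
  have hdiam : distDiam d A = 0 := by
    refine le_bot_iff.1 (iSup₂_le fun x hx => iSup₂_le fun y hy => ?_)
    rw [hA hx hy, hd]
    exact le_rfl
  have h0 : hausdorffMeasureOf d s A ≤ 0 := by
    refine iSup₂_le fun ρ hρ => iInf_le_of_le (fun _ => A) (iInf_le_of_le
      (subset_iUnion (fun _ : ℕ => A) 0) (iInf_le_of_le (fun _ => by simp [hdiam]) ?_))
    simp [hdiam, ENNReal.zero_rpow_of_pos hs0]
  rw [hs] at h0
  simp at h0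

/-- A real Lipschitz function maps a set of finite measure in dimension less than one to a null
set. -/
theorem volume_image_eq_zero_of_hausdorffMeasureOf_ne_top {f : M → ℝ} {K : ℝ≥0}
    (hf : ∀ x y, edist (f x) (f y) ≤ K * d x y) {s : ℝ} (hs0 : 0 ≤ s) (hs1 : s < 1) {A : Set M}
    (hA : hausdorffMeasureOf d s A ≠ ⊤) : volume (f '' A) = 0 := by
  set m := hausdorffMeasureOf d s A with hm
  -- A piece of diameter `t ≤ ρ` has image of length at most `K t ≤ K ρ ^ (1 - s) t ^ s`. The factor
  -- `ρ ^ (1 - s)` tends to `0`; the `+ 1` is slack for choosing a cover.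
  have key : ∀ ρ : ENNReal, 0 < ρ → volume (f '' A) ≤ K * ρ ^ (1 - s) * (m + 1) := by
    intro ρ hρ
    have h1 : (⨅ (U : ℕ → Set M) (_ : A ⊆ ⋃ n, U n) (_ : ∀ n, distDiam d (U n) ≤ ρ),
        ∑' n, ⨆ _ : (U n).Nonempty, distDiam d (U n) ^ s) < m + 1 :=
      (le_iSup₂_of_le (f := fun (ρ : ENNReal) (_ : 0 < ρ) => ⨅ (U : ℕ → Set M)
        (_ : A ⊆ ⋃ n, U n) (_ : ∀ n, distDiam d (U n) ≤ ρ),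
        ∑' n, ⨆ _ : (U n).Nonempty, distDiam d (U n) ^ s) ρ hρ le_rfl).trans_lt
        (ENNReal.lt_add_right hA one_ne_zero)
    simp only [iInf_lt_iff] at h1
    obtain ⟨U, hAU, hU, h1⟩ := h1
    have h2 : ∀ n, volume (f '' U n) ≤
        K * ρ ^ (1 - s) * ⨆ _ : (U n).Nonempty, distDiam d (U n) ^ s := by
      intro n
      rcases (U n).eq_empty_or_nonempty with he | hne
      · simp [he]
      rw [iSup_pos hne]
      refine (Real.volume_le_diam _).trans ?_
      have hdiam : Metric.ediam (f '' U n) ≤ K * distDiam d (U n) := by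
        refine Metric.ediam_image_le_iff.2 fun x hx y hy => ?_
        refine (hf x y).trans ?_
        gcongr
        exact le_iSup₂_of_le x hx (le_iSup₂_of_le (f := fun y _ => d x y) y hy le_rfl)
      refine hdiam.trans ?_
      rw [mul_assoc]
      gcongr
      calc distDiam d (U n) = distDiam d (U n) ^ ((1 - s) + s) := by simp
          _ = distDiam d (U n) ^ (1 - s) * distDiam d (U n) ^ s :=
            ENNReal.rpow_add_of_nonneg _ _ (by linarith) hs0
          _ ≤ ρ ^ (1 - s) * distDiam d (U n) ^ s :=
            mul_le_mul_left (ENNReal.rpow_le_rpow (hU n) (by linarith)) _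
    calc volume (f '' A) ≤ volume (⋃ n, f '' U n) := by
          rw [← image_iUnion]; exact measure_mono (image_mono hAU)
      _ ≤ ∑' n, volume (f '' U n) := measure_iUnion_le _
      _ ≤ ∑' n, K * ρ ^ (1 - s) * ⨆ _ : (U n).Nonempty, distDiam d (U n) ^ s :=
        ENNReal.tsum_le_tsum h2
      _ ≤ K * ρ ^ (1 - s) * (m + 1) := by
        rw [ENNReal.tsum_mul_left]
        gcongr
  have hlim : Filter.Tendsto (fun ρ : ENNReal => K * ρ ^ (1 - s) * (m + 1))
      (nhdsWithin 0 (Ioi 0)) (nhds (K * 0 ^ (1 - s) * (m + 1))) := by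
    refine Filter.Tendsto.mono_left ?_ nhdsWithin_le_nhds
    refine ENNReal.Tendsto.mul_const (ENNReal.Tendsto.const_mul
      (ENNReal.continuous_rpow_const.tendsto 0) (Or.inr ENNReal.coe_ne_top))
      (Or.inr (by simp [hA]))
  rw [ENNReal.zero_rpow_of_pos (by linarith), mul_zero, zero_mul] at hlim
  exact le_bot_iff.1 (ge_of_tendsto hlim (by
    filter_upwards [self_mem_nhdsWithin] with ρ hρ using key ρ hρ))

end HausdorffMeasure

/-! ### Lipschitz functions non-differentiable on a null set -/

section NullSet

/-- A null set inside an open set `U` has an open neighbourhood that occupies at most a quarter of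
each component of `U`. -/
theorem exists_isOpen_volume_inter_connectedComponentIn_le {Z U : Set ℝ} (hZ : volume Z = 0)
    (hU : IsOpen U) (hZU : Z ⊆ U) : ∃ V, IsOpen V ∧ Z ⊆ V ∧ V ⊆ U ∧
      ∀ z ∈ U, volume (V ∩ connectedComponentIn U z) ≤ volume (connectedComponentIn U z) / 4 := by
  have hpos : ∀ x ∈ U, 0 < volume (connectedComponentIn U x) / 4 := fun x hx =>
    ENNReal.div_pos (hU.connectedComponentIn.measure_pos volume
      ⟨x, mem_connectedComponentIn hx⟩).ne' (by simp)
  have h1 : ∀ C : Set ℝ, ∃ V, IsOpen V ∧ Z ⊆ V ∧ (0 < volume C / 4 → volume V ≤ volume C / 4) := by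
    intro C
    by_cases hC : 0 < volume C / 4
    · obtain ⟨V, hV, hVo, hVC⟩ := Z.exists_isOpen_lt_of_lt (μ := volume) _ (hZ ▸ hC)
      exact ⟨V, hVo, hV, fun _ => hVC.le⟩
    · exact ⟨univ, isOpen_univ, subset_univ _, fun h => absurd h hC⟩
  choose W hWo hWZ hWC using h1
  -- Components are disjoint, so inside a component `C` only the neighbourhood `W C` chosen for it
  -- contributes.
  refine ⟨⋃ x ∈ U, W (connectedComponentIn U x) ∩ connectedComponentIn U x,
    isOpen_biUnion fun x _ => (hWo _).inter hU.connectedComponentIn, fun z hz =>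
      mem_biUnion (hZU hz) ⟨hWZ _ hz, mem_connectedComponentIn (hZU hz)⟩,
    iUnion₂_subset fun x _ => inter_subset_right.trans (connectedComponentIn_subset _ _), ?_⟩
  intro z hz
  refine (measure_mono ?_).trans (hWC _ (hpos z hz))
  rintro y ⟨hy, hyz⟩
  simp only [mem_iUnion] at hy
  obtain ⟨x, hx, hyW, hyx⟩ := hy
  rwa [connectedComponentIn_eq hyz, ← connectedComponentIn_eq hyx]

/-- As `z` separates `c` and `d`, the errors on the two sides add up to a multiple of `d - c`. -/
theorem HasDerivAt.eventually_abs_sub_le {g : ℝ → ℝ} {L z : ℝ} (h : HasDerivAt g L z) {ε : ℝ}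
    (hε : 0 < ε) : ∃ δ > 0, ∀ c d, c ≤ z → z ≤ d → d - c < δ →
      |g d - g c - L * (d - c)| ≤ ε * (d - c) := by
  have h1 := (hasDerivAt_iff_isLittleO.1 h).def hε
  obtain ⟨δ, hδ, h2⟩ := Metric.eventually_nhds_iff.1 h1
  refine ⟨δ, hδ, fun c d hc hd hcd => ?_⟩
  have hc' := h2 (y := c) (by rw [Real.dist_eq, abs_lt]; constructor <;> linarith)
  have hd' := h2 (y := d) (by rw [Real.dist_eq, abs_lt]; constructor <;> linarith)
  rw [Real.norm_eq_abs, Real.norm_eq_abs, smul_eq_mul, abs_of_nonpos (by linarith : c - z ≤ 0),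
    abs_le] at hc'
  rw [Real.norm_eq_abs, Real.norm_eq_abs, smul_eq_mul, abs_of_nonneg (by linarith : 0 ≤ d - z),
    abs_le] at hd'
  rw [abs_le]
  constructor <;> nlinarith

/-- An open connected set of reals of finite measure is an interval, up to endpoints. -/
theorem IsPreconnected.exists_Ioc_ae_eq {C : Set ℝ} (hC : IsPreconnected C)
    (hfin : volume C ≠ ⊤) {z : ℝ} (hz : z ∈ C) :
    ∃ c d, c ≤ z ∧ z ≤ d ∧ (Ioc c d : Set ℝ) =ᵐ[volume] C := by
  have hbd : ∀ x ∈ C, ∀ y ∈ C, y - x ≤ (volume C).toReal := by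
    intro x hx y hy
    rcases le_total y x with h | h
    · exact (sub_nonpos.2 h).trans ENNReal.toReal_nonneg
    · have h1 : volume (Icc x y) ≤ volume C := measure_mono (hC.ordConnected.out hx hy)
      rw [Real.volume_Icc] at h1
      exact (ENNReal.ofReal_le_iff_le_toReal hfin).1 h1
  have hb : BddBelow C := ⟨z - (volume C).toReal, fun x hx => by linarith [hbd x hx z hz]⟩
  have ha : BddAbove C := ⟨z + (volume C).toReal, fun x hx => by linarith [hbd z hz x hx]⟩
  have h1 : C ⊆ Icc (sInf C) (sSup C) := fun x hx => ⟨csInf_le hb hx, le_csSup ha hx⟩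
  have h2 : Ioo (sInf C) (sSup C) ⊆ C :=
    IsConnected.Ioo_csInf_csSup_subset ⟨⟨z, hz⟩, hC⟩ hb ha
  refine ⟨sInf C, sSup C, (h1 hz).1, (h1 hz).2, ?_⟩
  exact (Ioo_ae_eq_Ioc.symm.le.trans h2.eventuallyLE).antisymm
    (h1.eventuallyLE.trans Ioc_ae_eq_Icc.symm.le)

/-- For each null set of reals there is a Lipschitz function that is differentiable at none of its
points. -/
theorem exists_lipschitzWith_not_differentiableAt {Z : Set ℝ} (hZ : volume Z = 0) :
    ∃ g : ℝ → ℝ, LipschitzWith 1 g ∧ ∀ z ∈ Z, ¬ DifferentiableAt ℝ g z := by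
  obtain ⟨U₀, hZU₀, hU₀, hvol⟩ := Z.exists_isOpen_lt_of_lt (μ := volume) 1 (hZ ▸ one_pos)
  choose! V hVo hZV hVU hV using fun (U : Set ℝ) (h : IsOpen U ∧ Z ⊆ U) =>
    exists_isOpen_volume_inter_connectedComponentIn_le hZ h.1 h.2
  set U : ℕ → Set ℝ := fun n => V^[n] U₀ with hUdef
  have hUs : ∀ n, U (n + 1) = V (U n) := fun n => Function.iterate_succ_apply' V n U₀
  have hU : ∀ n, IsOpen (U n) ∧ Z ⊆ U n := by
    intro n
    induction n with
    | zero => exact ⟨hU₀, hZU₀⟩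
    | succ n ih => rw [hUs]; exact ⟨hVo _ ih, hZV _ ih⟩
  have hanti : Antitone U := antitone_nat_of_succ_le fun n => by
    rw [hUs]; exact hVU _ (hU n)
  have hquart : ∀ n, ∀ z ∈ U n, volume (U (n + 1) ∩ connectedComponentIn (U n) z) ≤
      volume (connectedComponentIn (U n) z) / 4 := fun n => by
    rw [hUs]; exact hV _ (hU n)
  have hsmall : ∀ z ∈ Z, ∀ n, volume (connectedComponentIn (U n) z) ≤ (1 / 4) ^ n := by
    intro z hz n
    induction n with
    | zero =>
      rw [pow_zero]
      exact (measure_mono (connectedComponentIn_subset _ _)).trans hvol.le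
    | succ n ih =>
      calc volume (connectedComponentIn (U (n + 1)) z)
          ≤ volume (U (n + 1) ∩ connectedComponentIn (U n) z) :=
            measure_mono (subset_inter (connectedComponentIn_subset _ _)
              (connectedComponentIn_mono z (hanti n.le_succ)))
        _ ≤ volume (connectedComponentIn (U n) z) / 4 := hquart n z ((hU n).2 hz)
        _ ≤ (1 / 4) ^ n / 4 := by gcongr
        _ = (1 / 4) ^ (n + 1) := by rw [pow_succ, ENNReal.div_eq_inv_mul]; simp [mul_comm]
  -- In the component of `U n` around a point of `Z`, the set `A` has density at least `3 / 4` for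
  -- even `n` and at most `1 / 4` for odd `n`. These components shrink to the point, so the slopes
  -- of `∫ 1_A` oscillate.
  set A : Set ℝ := ⋃ k : ℕ, U (2 * k) \ U (2 * k + 1) with hA
  have hAm : MeasurableSet A := MeasurableSet.iUnion fun k =>
    (hU _).1.measurableSet.diff (hU _).1.measurableSet
  have hint : ∀ a b, IntervalIntegrable (A.indicator (1 : ℝ → ℝ)) volume a b := fun a b =>
    ⟨(integrable_const (1 : ℝ)).indicator hAm, (integrable_const (1 : ℝ)).indicator hAm⟩
  set g : ℝ → ℝ := fun x => ∫ t in (0 : ℝ)..x, A.indicator (1 : ℝ → ℝ) t with hg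
  have hgsub : ∀ x y, g y - g x = ∫ t in x..y, A.indicator (1 : ℝ → ℝ) t := fun x y =>
    intervalIntegral.integral_interval_sub_left (hint _ _) (hint _ _)
  refine ⟨g, LipschitzWith.of_dist_le_mul fun x y => ?_, fun z hz hdiff => ?_⟩
  · rw [dist_comm, Real.dist_eq, hgsub, NNReal.coe_one, dist_comm, Real.dist_eq]
    refine intervalIntegral.norm_integral_le_of_norm_le_const (E := ℝ) fun t _ => ?_
    by_cases ht : t ∈ A <;> simp [ht]
  -- Two errors of `1 / 8` do not bridge the density gap `3 / 4 - 1 / 4`: the derivative would be at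
  -- least `5 / 8` and at most `3 / 8`.
  obtain ⟨δ, hδ, hst⟩ := hdiff.hasDerivAt.eventually_abs_sub_le (ε := 1 / 8) (by norm_num)
  have main : ∀ᶠ n in Filter.atTop, ∃ ℓ : ℝ, 0 < ℓ ∧ ∃ x : ℝ,
      |x - deriv g z * ℓ| ≤ 1 / 8 * ℓ ∧
      ENNReal.ofReal ℓ = volume (connectedComponentIn (U n) z) ∧
      ENNReal.ofReal x = volume (A ∩ connectedComponentIn (U n) z) ∧ 0 ≤ x := by
    have hlim : Filter.Tendsto (fun n : ℕ => ((1 : ENNReal) / 4) ^ n) Filter.atTop (nhds 0) :=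
      ENNReal.tendsto_pow_atTop_nhds_zero_of_lt_one (by
        rw [ENNReal.div_lt_iff (by simp) (by simp)]; norm_num)
    filter_upwards [hlim.eventually (gt_mem_nhds (ENNReal.ofReal_pos.2 hδ))] with n hn
    have hvn := (hsmall z hz n).trans_lt hn
    have hzC : z ∈ connectedComponentIn (U n) z := mem_connectedComponentIn ((hU n).2 hz)
    obtain ⟨c, d, hcz, hzd, hae⟩ := isPreconnected_connectedComponentIn.exists_Ioc_ae_eq
      (hvn.trans_le le_top).ne hzC
    have hCd : volume (connectedComponentIn (U n) z) = ENNReal.ofReal (d - c) := by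
      rw [← measure_congr hae, Real.volume_Ioc]
    have hpos : 0 < d - c := by
      rw [← ENNReal.ofReal_pos, ← hCd]
      exact (hU n).1.connectedComponentIn.measure_pos volume ⟨z, hzC⟩
    have hx : g d - g c = (volume (A ∩ connectedComponentIn (U n) z)).toReal := by
      rw [hgsub, intervalIntegral.integral_of_le (hcz.trans hzd), setIntegral_indicator hAm]
      simp only [Pi.one_apply, integral_const, smul_eq_mul, mul_one]
      rw [measureReal_def, Measure.restrict_apply_univ, inter_comm]
      congr 1
      exact measure_congr ((ae_eq_refl A).inter hae)
    refine ⟨d - c, hpos, g d - g c, ?_, hCd.symm, ?_, ?_⟩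
    · refine hst c d hcz hzd ?_
      rw [hCd] at hvn
      exact (ENNReal.ofReal_lt_ofReal_iff hδ).1 hvn
    · rw [hx, ENNReal.ofReal_toReal]
      exact ((measure_mono inter_subset_right).trans_lt (hvn.trans_le le_top)).ne
    · rw [hx]; exact ENNReal.toReal_nonneg
  have heven : ∀ k, volume (connectedComponentIn (U (2 * k)) z) ≤
      volume (A ∩ connectedComponentIn (U (2 * k)) z) +
        volume (connectedComponentIn (U (2 * k)) z) / 4 := by
    intro k
    refine (measure_mono ?_).trans ((measure_union_le _ _).trans
      (add_le_add_right (hquart (2 * k) z ((hU _).2 hz)) _))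
    intro y hy
    by_cases hyU : y ∈ U (2 * k + 1)
    · exact Or.inr ⟨hyU, hy⟩
    · exact Or.inl ⟨mem_iUnion.2 ⟨k, connectedComponentIn_subset _ _ hy, hyU⟩, hy⟩
  have hodd : ∀ k, volume (A ∩ connectedComponentIn (U (2 * k + 1)) z) ≤
      volume (connectedComponentIn (U (2 * k + 1)) z) / 4 := by
    intro k
    refine (measure_mono ?_).trans (hquart (2 * k + 1) z ((hU _).2 hz))
    rintro y ⟨hyA, hy⟩
    refine ⟨?_, hy⟩
    obtain ⟨j, hj, hj'⟩ := mem_iUnion.1 hyA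
    have hyU := connectedComponentIn_subset _ _ hy
    have : k < j := by
      by_contra hle
      exact hj' (hanti (by omega) hyU)
    exact hanti (by omega) hj
  obtain ⟨n₀, hn₀⟩ := Filter.eventually_atTop.1 main
  obtain ⟨ℓ, hℓ, x, hx, hℓC, hxC, hx0⟩ := hn₀ (2 * n₀) (by omega)
  obtain ⟨ℓ', hℓ', x', hx', hℓC', hxC', hx0'⟩ := hn₀ (2 * n₀ + 1) (by omega)
  have h4 : (4 : ENNReal) = ENNReal.ofReal 4 := by simp
  have h1 := heven n₀
  rw [← hℓC, ← hxC, h4, ← ENNReal.ofReal_div_of_pos (by norm_num),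
    ← ENNReal.ofReal_add hx0 (by positivity), ENNReal.ofReal_le_ofReal_iff (by positivity)] at h1
  have h2 := hodd n₀
  rw [← hℓC', ← hxC', h4, ← ENNReal.ofReal_div_of_pos (by norm_num),
    ENNReal.ofReal_le_ofReal_iff (by positivity)] at h2
  rw [abs_le] at hx hx'
  have h5 : 5 / 8 ≤ deriv g z := by
    refine le_of_mul_le_mul_right ?_ hℓ
    linarith
  have h6 : deriv g z ≤ 3 / 8 := by
    refine le_of_mul_le_mul_right ?_ hℓ'
    linarith
  linarith

end NullSet

/-! ### Lower bound for the dimension -/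

section Dimension

variable {E : Type*} [NormedAddCommGroup E] [NormedSpace ℝ E] [FiniteDimensional ℝ E]
  {G : Type*} [TopologicalSpace G] [ChartedSpace E G] [Group G]
  [LieGroup 𝓘(ℝ, E) ∞ G] {r : ℕ}

/-- The translated one-parameter subgroup on `[0, 1]` is horizontal with constant control `w`. -/
theorem ccDist_mul_lieExp_le [T2Space G] (X : Fin r → GroupLieAlgebra 𝓘(ℝ, E) G)
    (w : EuclideanSpace ℝ (Fin r)) (x : G) :
    ccDist X x (x * lieExp (horizontalVector X w : GroupLieAlgebra 𝓘(ℝ, E) G)) ≤ ‖w‖ₑ := by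
  have : CompleteSpace E := FiniteDimensional.complete ℝ E
  set v : GroupLieAlgebra 𝓘(ℝ, E) G := horizontalVector X w with hv
  set γ : ℝ → G := fun t => lieExp (t • v) with hγ
  have hcurve := isMIntegralCurve_lieExp_smul (E := E) (G := G) v
  have hcont : Continuous γ := hcurve.continuous
  have h : IsHorizontalCurve X 0 1 γ (fun _ => w) := by
    refine IsHorizontalCurve.of_ae_hasMFDerivAt ⟨hcont.continuousOn, fun φ hφ => ?_⟩
      (integrable_const w) (Filter.Eventually.of_forall hcurve)
    have hd : ∀ t, HasDerivAt (φ ∘ γ) (frameDeriv E φ (γ t) v) t := fun t =>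
      (hcurve t).hasDerivAt_comp_of_mulInvariant hφ.contMDiffAt
    have hC1 : ContDiff ℝ 1 (φ ∘ γ) := by
      refine contDiff_one_iff_deriv.2 ⟨fun t => (hd t).differentiableAt, ?_⟩
      rw [funext fun t => (hd t).deriv]
      exact ((continuous_frameDeriv hφ).comp hcont).clm_apply continuous_const
    exact hC1.contDiffOn.absolutelyContinuousOnInterval
  refine (le_of_eq ?_).trans (((h.mul_left x).ccDist_le zero_le_one).trans (le_of_eq ?_))
  · simp [hγ, lieExp_zero]
  · simp

theorem ccDist_self [T2Space G] (X : Fin r → GroupLieAlgebra 𝓘(ℝ, E) G) (x : G) :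
    ccDist X x x = 0 := by
  have : CompleteSpace E := FiniteDimensional.complete ℝ E
  have h := ccDist_mul_lieExp_le X 0 x
  rw [map_zero, enorm_zero] at h
  have h0 : (lieExp (show GroupLieAlgebra 𝓘(ℝ, E) G from (0 : E)) : G) = 1 := lieExp_zero
  rw [h0, mul_one] at h
  exact le_bot_iff.1 h

theorem ccDist_mul_lieExp_smul_le [T2Space G] (X : Fin r → GroupLieAlgebra 𝓘(ℝ, E) G) (j : Fin r)
    (t : ℝ) (x : G) : ccDist X x (x * lieExp (t • X j)) ≤ ‖t‖ₑ := by
  have h := ccDist_mul_lieExp_le X (EuclideanSpace.single j t) x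
  have hv : (horizontalVector X (EuclideanSpace.single j t) : GroupLieAlgebra 𝓘(ℝ, E) G) =
      t • X j := by
    rw [horizontalVector_apply, Finset.sum_eq_single j] <;> simp +contextual
    rfl
  rw [hv] at h
  refine h.trans (le_of_eq ?_)
  rw [← ofReal_norm, PiLp.norm_single, ofReal_norm]

/-- A function that is Pansu differentiable has directional derivatives along horizontal
one-parameter subgroups. -/
theorem IsPansuDifferentiableAt.differentiableAt_comp_lieExp [T2Space G] {S : Stratification E G}
    {X : Fin r → GroupLieAlgebra 𝓘(ℝ, E) G} {f : G → ℝ} {x : G}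
    (h : IsPansuDifferentiableAt S X f x) {j : Fin r} (hj : X j ∈ S.horizontal) :
    DifferentiableAt ℝ (fun t : ℝ => f (x * lieExp (t • X j))) 0 := by
  have : CompleteSpace E := FiniteDimensional.complete ℝ E
  obtain ⟨L, hL, hdiff⟩ := h
  refine HasDerivAt.differentiableAt (f' := L (lieExp (X j)))
    (hasDerivAt_iff_isLittleO.2 (Asymptotics.isLittleO_iff.2 fun ε hε => ?_))
  lift ε to ℝ≥0 using hε.le
  obtain ⟨δ, hδ, hb⟩ := hdiff ε (by exact_mod_cast hε)
  filter_upwards [Metric.ball_mem_nhds (0 : ℝ) (by exact_mod_cast hδ : (0 : ℝ) < δ)] with t ht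
  have hd := ccDist_mul_lieExp_smul_le X j t x
  have ht' : ‖t‖ₑ < δ := by
    rw [mem_ball_zero_iff] at ht
    rw [enorm_eq_nnnorm]
    exact_mod_cast ht
  have h1 := (hb _ (hd.trans_lt ht')).trans (mul_le_mul_right hd _)
  rw [inv_mul_cancel_left, hL.lieExp_smul hj] at h1
  rw [zero_smul, lieExp_zero, mul_one, sub_zero, smul_eq_mul, Real.norm_eq_abs]
  rw [← ofReal_norm, ← ENNReal.ofReal_coe_nnreal, ← ENNReal.ofReal_mul ε.coe_nonneg,
    ENNReal.ofReal_le_ofReal_iff (by positivity)] at h1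
  exact h1

/-- Universal differentiability sets in groups with nontrivial horizontal layer have dimension at
least one. -/
theorem IsUDS.one_le_ccDimH [T2Space G] [SimplyConnectedSpace G] {S : Stratification E G}
    (X : Module.Basis (Fin r) ℝ S.horizontal) (j : Fin r) {N : Set G}
    (hN : IsUDS S (fun i => (X i : GroupLieAlgebra 𝓘(ℝ, E) G)) N) :
    1 ≤ ccDimH (fun i => (X i : GroupLieAlgebra 𝓘(ℝ, E) G)) N := by
  by_contra hlt
  obtain ⟨s, hs, hs1⟩ := ENNReal.lt_iff_exists_nnreal_btwn.1 (not_le.1 hlt)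
  have hfin : hausdorffMeasureOf (ccDist fun i => (X i : GroupLieAlgebra 𝓘(ℝ, E) G)) s N ≠ ⊤ :=
    fun h => hs.not_ge (le_iSup₂_of_le (f := fun (s : ℝ≥0) _ => (s : ENNReal)) s h le_rfl)
  -- `p` is the `j`-th horizontal coordinate. It grows at unit speed along `exp (t X_j)`, so Pansu
  -- differentiability of `g ∘ p` at `x` would make `g` differentiable at `p x`.
  obtain ⟨p, hps, hp, hpX⟩ := S.exists_isGLinear (X.coord j)
  obtain ⟨K, hK⟩ := isCCLipschitz_of_additive
    (X := fun i => (X i : GroupLieAlgebra 𝓘(ℝ, E) G)) hp.1 hps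
  obtain ⟨g, hg, hgd⟩ := exists_lipschitzWith_not_differentiableAt
    (volume_image_eq_zero_of_hausdorffMeasureOf_ne_top hK s.2 (by exact_mod_cast hs1) hfin)
  obtain ⟨x, hx, hdiff⟩ := hN (fun y => g (p y)) ⟨K, fun y z =>
    (by simpa using hg (p y) (p z) : edist (g (p y)) (g (p z)) ≤ edist (p y) (p z)).trans (hK y z)⟩
  refine hgd (p x) (mem_image_of_mem p hx) ?_
  have h1 := hdiff.differentiableAt_comp_lieExp (X j).2
  have h2 : ∀ t : ℝ, p (x * lieExp (t • (X j : GroupLieAlgebra 𝓘(ℝ, E) G))) = p x + t := by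
    intro t
    have h3 := hpX (t • X j)
    rw [map_smul, Module.Basis.coord_apply, Module.Basis.repr_self, Finsupp.single_eq_same, smul_eq_mul,
      mul_one] at h3
    rw [hp.1]
    exact congrArg (p x + ·) h3
  simp only [h2] at h1
  have h4 : DifferentiableAt ℝ (fun y : ℝ => g (p x + (y - p x))) (p x) :=
    DifferentiableAt.comp (f := fun y : ℝ => y - p x) (g := fun t => g (p x + t)) (p x)
      (by rwa [sub_self]) (differentiableAt_id.sub_const _)
  simpa using h4

/-- A Carnot group with trivial horizontal layer is a point. -/
theorem Stratification.subsingleton_of_horizontal_eq_bot [PreconnectedSpace G]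
    (S : Stratification E G) (h : S.horizontal = ⊥) : Subsingleton G := by
  have : CompleteSpace E := FiniteDimensional.complete ℝ E
  have hlg := lieGroup_minSmoothness E G
  have h0 : ∀ v : GroupLieAlgebra 𝓘(ℝ, E) G, v = 0 := by
    refine S.induction_on_layers (fun i h1 hi v hv => ?_) rfl
      fun v w hv hw => by rw [hv, hw, add_zero]
    rcases h1.eq_or_lt with rfl | h2
    · exact (Submodule.mem_bot ℝ).1 (h ▸ hv)
    · obtain ⟨k, rfl⟩ : ∃ k, i = k + 1 := ⟨i - 1, by omega⟩
      rw [S.layer_succ k (by omega) hi] at hv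
      refine (Submodule.mem_bot ℝ).1 (Submodule.span_le.2 ?_ hv)
      rintro z ⟨x, hx, y, -, rfl⟩
      rw [(Submodule.mem_bot ℝ).1 (h ▸ hx : x ∈ (⊥ : Submodule ℝ _)), zero_lie]
      exact Submodule.zero_mem _
  -- The charts then have one-point domains, so `G` is discrete as well as connected.
  have hE : Subsingleton E := ⟨fun v w => (h0 v).trans (h0 w).symm⟩
  have hd : DiscreteTopology G := by
    refine discreteTopology_iff_forall_isOpen.2 fun s => isOpen_iff_mem_nhds.2 fun g hg => ?_
    refine Filter.mem_of_superset (extChartAt_source_mem_nhds (I := 𝓘(ℝ, E)) g) fun y hy => ?_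
    rwa [(extChartAt 𝓘(ℝ, E) g).injOn hy (mem_extChartAt_source (I := 𝓘(ℝ, E)) g)
      (Subsingleton.elim _ _)]
  exact PreconnectedSpace.trivial_of_discrete

end Dimension

end

/-! ### The main theorem -/

theorem proposition6
    {E : Type*} [NormedAddCommGroup E] [NormedSpace ℝ E] [FiniteDimensional ℝ E]
    {E' : Type*} [NormedAddCommGroup E'] [NormedSpace ℝ E'] [FiniteDimensional ℝ E']
    {G : Type*} [TopologicalSpace G] [T2Space G] [SecondCountableTopology G]
    [ChartedSpace E G] [Group G] [LieGroup 𝓘(ℝ, E) ∞ G] [SimplyConnectedSpace G]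
    {H : Type*} [TopologicalSpace H] [T2Space H] [SecondCountableTopology H]
    [ChartedSpace E' H] [Group H] [LieGroup 𝓘(ℝ, E') ∞ H] [SimplyConnectedSpace H]
    (S : Stratification E G) (T : Stratification E' H) (r : ℕ)
    (X : Module.Basis (Fin r) ℝ S.horizontal) (Y : Module.Basis (Fin r) ℝ T.horizontal)
    (F : G →* H) (hF : ContMDiff 𝓘(ℝ, E) 𝓘(ℝ, E') ∞ F)
    (hFX : ∀ i, mfderiv 𝓘(ℝ, E) 𝓘(ℝ, E') F 1 (X i : GroupLieAlgebra 𝓘(ℝ, E) G) =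
      (Y i : GroupLieAlgebra 𝓘(ℝ, E') H))
    (N : Set G) (hN : IsUDS S (fun i => (X i : GroupLieAlgebra 𝓘(ℝ, E) G)) N) :
    IsUDS T (fun i => (Y i : GroupLieAlgebra 𝓘(ℝ, E') H)) (F '' N) ∧
      (ccDimH (fun i => (X i : GroupLieAlgebra 𝓘(ℝ, E) G)) N = 1 →
        ccDimH (fun i => (Y i : GroupLieAlgebra 𝓘(ℝ, E') H)) (F '' N) = 1) := by
  have himage := hN.image X Y hF hFX
  refine ⟨himage, fun hdim => le_antisymm ?_ ?_⟩
  · exact (hausdorffDimOf_image_le (ccDist_map_le hF hFX) N).trans hdim.le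
  -- For `r = 0` the group `G` is a point, and `N` has dimension zero, against the assumption.
  · rcases Nat.eq_zero_or_pos r with rfl | hr
    · have hbot : S.horizontal = ⊥ := by
        have : Subsingleton S.horizontal := X.repr.toEquiv.subsingleton
        exact Submodule.subsingleton_iff_eq_bot.1 this
      have := S.subsingleton_of_horizontal_eq_bot hbot
      have h0 := hausdorffDimOf_subsingleton
        (ccDist_self fun i => (X i : GroupLieAlgebra 𝓘(ℝ, E) G)) (subsingleton_of_subsingleton (s := N))
      exact absurd (h0.symm.trans hdim) zero_ne_one
    · exact himage.one_le_ccDimH Y ⟨0, hr⟩
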